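/- **Setting.** Consider $n$ qudits, indexed by $\{1,\dots,n\}$ with indices taken modulo $n$, of arbitrary (possibly different) finite dimensions. Let $H=\sum_{i=1}^n H_i$ with $H_i=\sum_j P_{ij}$ a finite sum, where each $P_{ij}$ is an orthogonal projector acting nontrivially only on qudits $i,i+1$. Assume that - $H$ is frustration-free, i.e. its ground energy (least eigenvalue) is $0$; - each term $P_{ij}$ fails to commute with at most $g$ of the other terms (terms are counted by their indices $(i,j)$); - the terms can be divided into $L$ layers such that the terms within each layer mutually commute. This is the closed chain; an open chain is the case $H_n=0$. For a contiguous set $S$ of qudits let $h_S=\sum_{i:\,i,i+1\in S}H_i$, and let $\gamma(S)$ be the smallest nonzero eigenvalue of $h_S$ (with $\gamma(S)=+\infty$ if $h_S=0$). Let $\gamma$ be the smallest nonzero eigenvalue of $H$ (with $\gamma=+\infty$ if $H=0$), and let $\gamma(t)=\min_a\gamma(\{a,a+1,\dots,a+t-1\})$, where $a$ ranges over $\{1,\dots,n\}$ for the closed chain and over $\{1,\dots,n-t+1\}$ for the open chain. **Theorem.** Suppose $\gamma\le g^2/4$. Then for every integer $t$ with $8L^2<t<n/5$, $$\gamma(t)\le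 \frac{10^3L^2g^2}{t^2}+6\gamma ,$$ both for the closed chain and for the open chain. -/

import Mathlib

namespace QuditChain

/-- Computational basis strings of `n` qudits with local dimensions `d i`. The Hilbert space of the
chain is the space of complex functions on these strings, and operators are complex matrices
indexed by them. -/
abbrev Config {n : ℕ} (d : Fin n → ℕ) : Type := ∀ i : Fin n, Fin (d i)

/-- Operators on the chain. -/
abbrev Op {n : ℕ} (d : Fin n → ℕ) : Type := Matrix (Config d) (Config d) ℂ

/-- `A` acts nontrivially only on the qudits in `S`: it is `B ⊗ 1` with `B` an operator on the
qudits in `S` and `1` the identity on the remaining qudits. -/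
def SupportedOn {n : ℕ} {d : Fin n → ℕ} (S : Finset (Fin n)) (A : Op d) : Prop :=
  ∃ B : Matrix (∀ i : S, Fin (d i)) (∀ i : S, Fin (d i)) ℂ, ∀ x y : Config d,
    A x y = if ∀ i, i ∉ S → x i = y i then B (fun i => x i) (fun i => y i) else 0

/-- The set of (real) eigenvalues of an operator. -/
def eigenvalues {n : ℕ} {d : Fin n → ℕ} (A : Op d) : Set ℝ :=
  {x : ℝ | Module.End.HasEigenvalue (Matrix.toLin' A) (x : ℂ)}

/-- The spectral gap: the smallest nonzero eigenvalue (`⊤` if there is none). -/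
noncomputable def gap {n : ℕ} {d : Fin n → ℕ} (A : Op d) : EReal :=
  sInf (Real.toEReal '' {x : ℝ | x ∈ eigenvalues A ∧ x ≠ 0})

/-- The interaction `H_i = ∑_j P_{ij}`. -/
def interaction {n : ℕ} {d m : Fin n → ℕ} (P : ∀ i : Fin n, Fin (m i) → Op d)
    (i : Fin n) : Op d :=
  ∑ j, P i j

/-- The full Hamiltonian `H = ∑_i H_i`. -/
def hamiltonian {n : ℕ} {d m : Fin n → ℕ} (P : ∀ i : Fin n, Fin (m i) → Op d) : Op d :=
  ∑ i, interaction P i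

/-- The contiguous segment of the `t` qudits `a, a + 1, …, a + t - 1`, with indices mod `n`. -/
def segment {n : ℕ} [NeZero n] (a : Fin n) (t : ℕ) : Finset (Fin n) :=
  (Finset.range t).image fun k => a + Fin.ofNat n k

/-- `h_S`: the sum of the interactions `H_i` with both `i` and `i + 1` (mod `n`) in `S`. -/
def localHamiltonian {n : ℕ} [NeZero n] {d m : Fin n → ℕ}
    (P : ∀ i : Fin n, Fin (m i) → Op d) (S : Finset (Fin n)) : Op d :=
  ∑ i with i ∈ S ∧ i + 1 ∈ S, interaction P i

/-- `γ(t)` on the closed chain: the minimum gap over all `n` cyclic segments of length `t`. -/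
noncomputable def closedLocalGap {n : ℕ} [NeZero n] {d m : Fin n → ℕ}
    (P : ∀ i : Fin n, Fin (m i) → Op d) (t : ℕ) : EReal :=
  ⨅ a : Fin n, gap (localHamiltonian P (segment a t))

/-- `γ(t)` on the open chain: the minimum gap over the segments of length `t` that do not wrap
around the end of the chain. -/
noncomputable def openLocalGap {n : ℕ} [NeZero n] {d m : Fin n → ℕ}
    (P : ∀ i : Fin n, Fin (m i) → Op d) (t : ℕ) : EReal :=
  ⨅ a : {a : Fin n // (a : ℕ) + t ≤ n}, gap (localHamiltonian P (segment a.1 t))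

/-- The ground energy (least eigenvalue) is zero. For a sum of projectors this is
frustration-freeness. -/
def FrustrationFree {n : ℕ} {d m : Fin n → ℕ} (P : ∀ i : Fin n, Fin (m i) → Op d) : Prop :=
  IsLeast (eigenvalues (hamiltonian P)) 0

end QuditChain

/-! Write `G`, `G_A`, `G_B` for the common kernels of all the terms and of two subfamilies `A` and
`B`. Here `B` is a row of disjoint segments of length `t` around the chain, and `A` is a second row,
one segment over each gap between consecutive segments of `B`. Within a row the segments commute, so
each row has gap at least `Γ = γ(t)`.

Let `D` be the product of all the `1 - P i`, ordered by layers, and `T = D†D`. The detectability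
lemma (`detectability_lemma`) gives `T ≤ g²/(g² + γ)` on `Gᗮ`. A rescaled Chebyshev polynomial `p`
of degree at most `q` with `p(1) = 1` then contracts `Gᗮ` by `ε = 1/(1 + x)`, `x = 2γq²/g²`; the
gain is quadratic in `q`.

On the other hand `p(T)` is local. A vector of `G_B` has energy only in the gaps of `B`, and each
layer spreads this energy by one bond. As long as `2Lq` layers stay inside `A`, `p(T)φ - φ` is
orthogonal to `G_A` (`complProd_layers_pow`, `aeval_apply_sub_mem`). So the projection onto `G_A`
does not distinguish `φ` from `p(T)φ`, and it has norm at most `ε` on `G_B ∩ Gᗮ`.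

Two projections that are this close to orthogonal satisfy `(1 - E_A) + (1 - E_B) ≥ 1 - ε` on `Gᗮ`.
Testing on an eigenvector of `H` at `γ` gives `Γ(1 - ε) ≤ 2γ`, that is, `Γ ≤ 2γ + g²/q²`
(`subfamily_gap_le`). The geometry allows `q` of order `t/L`, which yields the theorem. -/

open Polynomial

/-! ### Growth of Chebyshev polynomials outside `[-1, 1]` -/

section Chebyshev

/-- By the recurrence, consecutive increments of `T_q(1 + δ)` grow by `2δ T_{q+1}(1 + δ) ≥ 2δ`. So
the `q`-th increment is at least `(2q + 1)δ`, and these odd numbers sum to `q²`. -/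
theorem one_add_sq_mul_le_eval_chebyshev_T {δ : ℝ} (hδ : 0 ≤ δ) (q : ℕ) :
    1 + (q : ℝ) ^ 2 * δ ≤ (Chebyshev.T ℝ q).eval (1 + δ) := by
  have key : ∀ q : ℕ, 1 + (q : ℝ) ^ 2 * δ ≤ (Chebyshev.T ℝ q).eval (1 + δ) ∧
      (2 * q + 1) * δ ≤
        (Chebyshev.T ℝ (q + 1 : ℕ)).eval (1 + δ) - (Chebyshev.T ℝ q).eval (1 + δ) := by
    intro q
    induction q with
    | zero => simp
    | succ q ih =>
      obtain ⟨h1, h2⟩ := ih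
      have h3 : (1 : ℝ) ≤ (Chebyshev.T ℝ (q + 1 : ℕ)).eval (1 + δ) :=
        Chebyshev.one_le_eval_T_real _ (by linarith)
      have h4 : (Chebyshev.T ℝ (q + 1 + 1 : ℕ)).eval (1 + δ) =
          2 * (1 + δ) * (Chebyshev.T ℝ (q + 1 : ℕ)).eval (1 + δ)
            - (Chebyshev.T ℝ q).eval (1 + δ) := by
        have := Chebyshev.T_add_two ℝ (q : ℤ)
        push_cast
        rw [add_assoc, one_add_one_eq_two, this]
        simp
      push_cast at h2 h3 h4 ⊢
      refine ⟨by linarith, ?_⟩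
      rw [h4]
      nlinarith [mul_le_mul_of_nonneg_left h3 hδ]
  exact (key q).1

end Chebyshev

/-! ### Eigenbasis estimates and quadratic forms of the gap -/

section Spectral

variable {V : Type*} [NormedAddCommGroup V] [InnerProductSpace ℂ V] [FiniteDimensional ℂ V]

/-- If `p` is bounded by `C` on the part of the spectrum of `T` seen by `φ`, then
`‖p(T) φ‖ ≤ C ‖φ‖`. -/
theorem LinearMap.IsSymmetric.norm_aeval_apply_le {T : V →ₗ[ℂ] V} (hT : T.IsSymmetric)
    (p : ℝ[X]) {C : ℝ} (φ : V)
    (hp : ∀ (μ : ℝ) (e : V), T e = (μ : ℂ) • e → inner ℂ e φ ≠ 0 → |p.eval μ| ≤ C) (hC : 0 ≤ C) :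
    ‖aeval T (p.map (algebraMap ℝ ℂ)) φ‖ ≤ C * ‖φ‖ := by
  set b := hT.eigenvectorBasis rfl
  have hb : ∀ i, T (b i) = ((hT.eigenvalues rfl i : ℝ) : ℂ) • b i :=
    fun i => hT.apply_eigenvectorBasis rfl i
  have hpb : ∀ i, aeval T (p.map (algebraMap ℝ ℂ)) (b i)
      = ((p.eval (hT.eigenvalues rfl i) : ℝ) : ℂ) • b i := by
    intro i
    have h := Module.End.aeval_apply_of_hasEigenvector (p := p.map (algebraMap ℝ ℂ))
      (hT.hasEigenvector_eigenvectorBasis rfl i)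
    rw [h]
    congr 1
    simp [eval_map_algebraMap, aeval_def]
    exact (eval₂_at_apply (algebraMap ℝ ℂ) _)
  have hsum : aeval T (p.map (algebraMap ℝ ℂ)) φ
      = ∑ i, (((p.eval (hT.eigenvalues rfl i) : ℝ) : ℂ) * inner ℂ (b i) φ) • b i := by
    conv_lhs => rw [← b.sum_repr' φ]
    rw [map_sum]
    refine Finset.sum_congr rfl fun i _ => ?_
    rw [map_smul, hpb, smul_smul, mul_comm]
  have hin : ∀ i, inner ℂ (b i) (aeval T (p.map (algebraMap ℝ ℂ)) φ)
      = ((p.eval (hT.eigenvalues rfl i) : ℝ) : ℂ) * inner ℂ (b i) φ := by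
    intro i
    rw [hsum]
    exact b.orthonormal.inner_right_fintype _ i
  have hsq : ‖aeval T (p.map (algebraMap ℝ ℂ)) φ‖ ^ 2 ≤ (C * ‖φ‖) ^ 2 := by
    rw [← b.sum_sq_norm_inner_right, mul_pow, ← b.sum_sq_norm_inner_right φ, Finset.mul_sum]
    refine Finset.sum_le_sum fun i _ => ?_
    rw [hin, norm_mul, mul_pow, Complex.norm_real, Real.norm_eq_abs]
    by_cases h0 : inner ℂ (b i) φ = 0
    · simp [h0]
    · gcongr
      exact hp _ _ (hb i) h0
  exact le_of_sq_le_sq hsq (by positivity)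

theorem LinearMap.IsSymmetric.re_inner_apply_eq_sum {T : V →ₗ[ℂ] V} (hT : T.IsSymmetric) (φ : V) :
    (inner ℂ φ (T φ)).re
      = ∑ i, hT.eigenvalues rfl i * ‖inner ℂ (hT.eigenvectorBasis rfl i) φ‖ ^ 2 := by
  set b := hT.eigenvectorBasis rfl
  have hin : ∀ i, inner ℂ (b i) (T φ) = ((hT.eigenvalues rfl i : ℝ) : ℂ) * inner ℂ (b i) φ := by
    intro i
    rw [← hT, hT.apply_eigenvectorBasis rfl i, inner_smul_left]
    simp
    exact Or.inl rfl
  rw [← b.sum_inner_mul_inner, Complex.re_sum]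
  refine Finset.sum_congr rfl fun i _ => ?_
  rw [hin, ← inner_conj_symm, mul_left_comm, Complex.conj_mul', ← Complex.ofReal_pow,
    ← Complex.ofReal_mul, Complex.ofReal_re]

theorem LinearMap.IsSymmetric.norm_apply_sq_eq_sum {T : V →ₗ[ℂ] V} (hT : T.IsSymmetric) (φ : V) :
    ‖T φ‖ ^ 2
      = ∑ i, hT.eigenvalues rfl i ^ 2 * ‖inner ℂ (hT.eigenvectorBasis rfl i) φ‖ ^ 2 := by
  set b := hT.eigenvectorBasis rfl
  have hin : ∀ i, inner ℂ (b i) (T φ) = ((hT.eigenvalues rfl i : ℝ) : ℂ) * inner ℂ (b i) φ := by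
    intro i
    rw [← hT, hT.apply_eigenvectorBasis rfl i, inner_smul_left]
    simp
    exact Or.inl rfl
  rw [← b.sum_sq_norm_inner_right]
  refine Finset.sum_congr rfl fun i _ => ?_
  rw [hin, norm_mul, mul_pow, Complex.norm_real, Real.norm_eq_abs, sq_abs]

/-- A lower bound on the nonzero eigenvalues of `h ≥ 0` gives `Γ h ≤ h²`. -/
theorem LinearMap.IsSymmetric.mul_re_inner_le_norm_sq {h : V →ₗ[ℂ] V} (hh : h.IsSymmetric) {Γ : ℝ}
    (hpos : ∀ v, 0 ≤ (inner ℂ v (h v)).re)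
    (hΓ : ∀ (μ : ℝ) (e : V), e ≠ 0 → h e = (μ : ℂ) • e → μ ≠ 0 → Γ ≤ μ) (v : V) :
    Γ * (inner ℂ v (h v)).re ≤ ‖h v‖ ^ 2 := by
  rw [hh.re_inner_apply_eq_sum, hh.norm_apply_sq_eq_sum, Finset.mul_sum]
  refine Finset.sum_le_sum fun i _ => ?_
  set μ := hh.eigenvalues rfl i
  set e := hh.eigenvectorBasis rfl i
  have he : h e = (μ : ℂ) • e := hh.apply_eigenvectorBasis rfl i
  have hn : ‖e‖ = 1 := (hh.eigenvectorBasis rfl).orthonormal.1 i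
  have hμ : 0 ≤ μ := by
    have := hpos e
    rw [he, inner_smul_right, inner_self_eq_norm_sq_to_K, hn] at this
    simpa using this
  rw [← mul_assoc]
  refine mul_le_mul_of_nonneg_right ?_ (by positivity)
  rcases eq_or_ne μ 0 with h0 | h0
  · simp [h0]
  · have := hΓ μ e (by rintro h; simp [h] at hn) he h0
    nlinarith

/-- If `Γ h ≤ h²` and `h ≥ 0`, then `h ≥ Γ` on the orthogonal complement of its kernel. -/
theorem LinearMap.IsSymmetric.mul_norm_sq_le_re_inner {h : V →ₗ[ℂ] V} (hh : h.IsSymmetric) {Γ : ℝ}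
    (hpos : ∀ v, 0 ≤ (inner ℂ v (h v)).re)
    (hΓ : ∀ v, Γ * (inner ℂ v (h v)).re ≤ ‖h v‖ ^ 2) {v : V}
    (hv : ∀ u, h u = 0 → inner ℂ u v = 0) :
    Γ * ‖v‖ ^ 2 ≤ (inner ℂ v (h v)).re := by
  rw [hh.re_inner_apply_eq_sum, ← (hh.eigenvectorBasis rfl).sum_sq_norm_inner_right v,
    Finset.mul_sum]
  refine Finset.sum_le_sum fun i _ => ?_
  set μ := hh.eigenvalues rfl i
  set e := hh.eigenvectorBasis rfl i
  have he : h e = (μ : ℂ) • e := hh.apply_eigenvectorBasis rfl i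
  have hn : ‖e‖ = 1 := (hh.eigenvectorBasis rfl).orthonormal.1 i
  rcases eq_or_ne μ 0 with h0 | h0
  · rw [hv e (by rw [he, h0]; simp)]
    simp
  · refine mul_le_mul_of_nonneg_right ?_ (by positivity)
    have h1 := hpos e
    have h2 := hΓ e
    rw [he, inner_smul_right, inner_self_eq_norm_sq_to_K, hn] at h1 h2
    rw [norm_smul, hn] at h2
    simp only [one_pow, mul_one, Complex.ofReal_re, Complex.norm_real,
      Real.norm_eq_abs, sq_abs, RCLike.ofReal_one] at h1 h2
    have : 0 < μ := lt_of_le_of_ne h1 (Ne.symm h0)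
    nlinarith

end Spectral
-- Ground spaces and products of complementary projections
namespace ProjectionFamily

variable {V : Type*} [NormedAddCommGroup V] [InnerProductSpace ℂ V] {ι : Type*}

/-- The common kernel of the terms in `S`. -/
def groundSpace (P : ι → V →ₗ[ℂ] V) (S : Set ι) : Submodule ℂ V :=
  ⨅ i ∈ S, LinearMap.ker (P i)

theorem mem_groundSpace {P : ι → V →ₗ[ℂ] V} {S : Set ι} {v : V} :
    v ∈ groundSpace P S ↔ ∀ i ∈ S, P i v = 0 := by
  simp [groundSpace]

theorem groundSpace_anti (P : ι → V →ₗ[ℂ] V) {S S' : Set ι} (h : S ⊆ S') :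
    groundSpace P S' ≤ groundSpace P S := fun v hv => by
  rw [mem_groundSpace] at hv ⊢
  exact fun i hi => hv i (h hi)

/-- The product of the complementary projections `1 - P i` along a list. -/
def complProd (P : ι → V →ₗ[ℂ] V) (l : List ι) : V →ₗ[ℂ] V :=
  (l.map fun i => 1 - P i).prod

@[simp] theorem complProd_nil (P : ι → V →ₗ[ℂ] V) (v : V) : complProd P [] v = v := by
  simp [complProd]

@[simp] theorem complProd_cons (P : ι → V →ₗ[ℂ] V) (i : ι) (l : List ι) (v : V) :
    complProd P (i :: l) v = complProd P l v - P i (complProd P l v) := by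
  simp [complProd]

theorem complProd_append (P : ι → V →ₗ[ℂ] V) (l l' : List ι) (v : V) :
    complProd P (l ++ l') v = complProd P l (complProd P l' v) := by
  simp [complProd]

theorem complProd_of_mem_groundSpace {P : ι → V →ₗ[ℂ] V} {v : V}
    (hv : v ∈ groundSpace P Set.univ) (l : List ι) : complProd P l v = v := by
  rw [mem_groundSpace] at hv
  induction l with
  | nil => simp
  | cons i l ih => simp [ih, hv i trivial]

section Projections

variable {P : ι → V →ₗ[ℂ] V} (hP : ∀ i, (P i).IsSymmetricProjection)
include hP

theorem apply_apply (i : ι) (v : V) : P i (P i v) = P i v :=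
  LinearMap.congr_fun (hP i).isIdempotentElem v

theorem re_inner_apply (i : ι) (v : V) : (inner ℂ v (P i v)).re = ‖P i v‖ ^ 2 := by
  rw [← apply_apply hP i v, ← (hP i).isSymmetric, apply_apply hP, inner_self_eq_norm_sq_to_K]
  norm_cast

theorem norm_sq_sub_apply (i : ι) (v : V) : ‖v - P i v‖ ^ 2 = ‖v‖ ^ 2 - ‖P i v‖ ^ 2 := by
  rw [@norm_sub_sq ℂ, RCLike.re_to_complex, re_inner_apply hP]
  ring

theorem norm_sub_apply_le (i : ι) (v : V) : ‖v - P i v‖ ≤ ‖v‖ := by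
  refine le_of_sq_le_sq ?_ (norm_nonneg _)
  rw [norm_sq_sub_apply hP]
  linarith [sq_nonneg ‖P i v‖]

theorem inner_complProd (l : List ι) (u v : V) :
    inner ℂ (complProd P l u) v = inner ℂ u (complProd P l.reverse v) := by
  induction l generalizing v with
  | nil => simp
  | cons i l ih =>
    rw [complProd_cons, inner_sub_left, (hP i).isSymmetric, ← inner_sub_right, ih,
      List.reverse_cons, complProd_append]
    simp

/-- The adjoint is the product in reverse order, which fixes every ground state. -/
theorem complProd_mem_orthogonal (l : List ι) {v : V} (hv : v ∈ (groundSpace P Set.univ)ᗮ) :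
    complProd P l v ∈ (groundSpace P Set.univ)ᗮ := by
  rw [Submodule.mem_orthogonal'] at hv ⊢
  intro u hu
  rw [inner_complProd hP, complProd_of_mem_groundSpace hu, hv u hu]

end Projections

/-! ### The detectability lemma -/

section DetectabilityLemma

open Classical in
/-- The norm of the part of `v` removed by the factor `1 - P j` when the product
`complProd P l` is applied to `v`. -/
noncomputable def removedNorm (P : ι → V →ₗ[ℂ] V) (v : V) : List ι → ι → ℝ
  | [], _ => 0
  | i :: l, j => removedNorm P v l j + if j = i then ‖P i (complProd P l v)‖ else 0

theorem removedNorm_nonneg (P : ι → V →ₗ[ℂ] V) (v : V) (l : List ι) (j : ι) :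
    0 ≤ removedNorm P v l j := by
  induction l with
  | nil => simp [removedNorm]
  | cons i l ih =>
    rw [removedNorm]
    split_ifs <;> positivity

theorem removedNorm_of_notMem (P : ι → V →ₗ[ℂ] V) (v : V) {l : List ι} {j : ι} (hj : j ∉ l) :
    removedNorm P v l j = 0 := by
  induction l with
  | nil => simp [removedNorm]
  | cons i l ih =>
    rw [List.mem_cons, not_or] at hj
    simp [removedNorm, ih hj.2, hj.1]

variable [Fintype ι] {P : ι → V →ₗ[ℂ] V} (hP : ∀ i, (P i).IsSymmetricProjection)
include hP

/-- Pythagoras at each factor; the losses telescope. Without repetitions each `removedNorm` is a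
single norm rather than a sum of several. -/
theorem sum_removedNorm_sq (v : V) {l : List ι} (hl : l.Nodup) :
    ∑ j, removedNorm P v l j ^ 2 = ‖v‖ ^ 2 - ‖complProd P l v‖ ^ 2 := by
  classical
  induction l with
  | nil => simp [removedNorm]
  | cons i l ih =>
    rw [List.nodup_cons] at hl
    have h : ∀ j, removedNorm P v (i :: l) j ^ 2
        = removedNorm P v l j ^ 2 + if j = i then ‖P i (complProd P l v)‖ ^ 2 else 0 := by
      intro j
      rw [removedNorm]
      split_ifs with hj
      · rw [hj, removedNorm_of_notMem P v hl.1]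
        ring
      · ring
    simp_rw [h]
    rw [Finset.sum_add_distrib, ih hl.2, complProd_cons, norm_sq_sub_apply hP]
    simp
    ring

open Classical in
-- Move `P i` through the product until it meets its own factor `1 - P i`, which kills it. Factors
-- that commute with `P i` cost nothing; any other factor `1 - P k` costs at most the norm it
-- removed.
theorem norm_apply_complProd_le (v : V) {l : List ι} {i : ι} (hi : i ∈ l) :
    ‖P i (complProd P l v)‖
      ≤ ∑ j with j ≠ i ∧ ¬ Commute (P i) (P j), removedNorm P v l j := by
  induction l with
  | nil => simp at hi
  | cons k l ih =>
    set u := complProd P l v with hu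
    have hle : ∑ j with j ≠ i ∧ ¬ Commute (P i) (P j), removedNorm P v l j
        ≤ ∑ j with j ≠ i ∧ ¬ Commute (P i) (P j), removedNorm P v (k :: l) j := by
      refine Finset.sum_le_sum fun j _ => ?_
      rw [removedNorm]
      split_ifs <;> simp
    rw [complProd_cons, ← hu]
    by_cases hik : i = k
    · subst hik
      rw [map_sub, apply_apply hP, sub_self, norm_zero]
      exact Finset.sum_nonneg fun j _ => removedNorm_nonneg P v _ j
    · have hil : i ∈ l := (List.mem_cons.1 hi).resolve_left hik
      by_cases hc : Commute (P i) (P k)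
      · have h1 : P i (P k u) = P k (P i u) := LinearMap.congr_fun hc.eq u
        rw [map_sub, h1]
        exact ((norm_sub_apply_le hP k _).trans (ih hil)).trans hle
      · have h1 : ‖P i (u - P k u)‖ ≤ ‖P i u‖ + ‖P k u‖ := by
          rw [map_sub]
          refine (norm_sub_le _ _).trans ?_
          gcongr
          refine le_of_sq_le_sq ?_ (norm_nonneg _)
          have := norm_sq_sub_apply hP i (P k u)
          nlinarith [sq_nonneg ‖P k u - P i (P k u)‖]
        refine h1.trans ?_
        simp_rw [removedNorm]
        rw [Finset.sum_add_distrib]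
        gcongr
        · exact ih hil
        · rw [Finset.sum_ite_eq', if_pos]
          simpa [Ne.symm hik] using hc

open Classical in
/-- The energy of `complProd P l v` is controlled by the norm lost in the product. -/
theorem sum_norm_apply_complProd_sq_le {g : ℕ}
    (hg : ∀ i, (Finset.univ.filter fun j => j ≠ i ∧ ¬ Commute (P i) (P j)).card ≤ g)
    {l : List ι} (hl : l.Nodup) (hmem : ∀ i, i ∈ l) (v : V) :
    ∑ i, ‖P i (complProd P l v)‖ ^ 2 ≤ (g : ℝ) ^ 2 * (‖v‖ ^ 2 - ‖complProd P l v‖ ^ 2) := by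
  rw [← sum_removedNorm_sq hP v hl]
  set w := removedNorm P v l
  calc ∑ i, ‖P i (complProd P l v)‖ ^ 2
      ≤ ∑ i, (∑ j with j ≠ i ∧ ¬ Commute (P i) (P j), w j) ^ 2 := by
        gcongr with i
        exact norm_apply_complProd_le hP v (hmem i)
    _ ≤ ∑ i, (g : ℝ) * ∑ j with j ≠ i ∧ ¬ Commute (P i) (P j), w j ^ 2 := by
        gcongr with i
        refine sq_sum_le_card_mul_sum_sq.trans ?_
        gcongr
        exact_mod_cast hg i
    -- Exchange of sums: non-commutation is symmetric, so each loss `w j` is counted at most `g`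
    -- times.
    _ = (g : ℝ) * ∑ j, ∑ i with i ≠ j ∧ ¬ Commute (P j) (P i), w j ^ 2 := by
        rw [← Finset.mul_sum]
        simp_rw [Finset.sum_filter]
        rw [Finset.sum_comm]
        simp_rw [ne_comm, commute_iff_eq, eq_comm]
    _ ≤ (g : ℝ) * ∑ j, (g : ℝ) * w j ^ 2 := by
        gcongr with j
        rw [Finset.sum_const, nsmul_eq_mul]
        gcongr
        exact_mod_cast hg j
    _ = (g : ℝ) ^ 2 * ∑ j, w j ^ 2 := by
        rw [← Finset.mul_sum]
        ring

open Classical in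
/-- The detectability lemma. -/
theorem detectability_lemma {g : ℕ}
    (hg : ∀ i, (Finset.univ.filter fun j => j ≠ i ∧ ¬ Commute (P i) (P j)).card ≤ g)
    {l : List ι} (hl : l.Nodup) (hmem : ∀ i, i ∈ l) {γ : ℝ}
    (hγ : ∀ v ∈ (groundSpace P Set.univ)ᗮ, γ * ‖v‖ ^ 2 ≤ ∑ i, ‖P i v‖ ^ 2)
    {v : V} (hv : v ∈ (groundSpace P Set.univ)ᗮ) :
    ((g : ℝ) ^ 2 + γ) * ‖complProd P l v‖ ^ 2 ≤ (g : ℝ) ^ 2 * ‖v‖ ^ 2 := by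
  have h1 := hγ _ (complProd_mem_orthogonal hP l hv)
  have h2 := sum_norm_apply_complProd_sq_le hP hg hl hmem v
  linarith

end DetectabilityLemma

/-! ### Light cone of a layered product -/

section LightCone

variable {P : ι → V →ₗ[ℂ] V} {R : ℕ → Set ι} {K : Submodule ℂ V} {N : ℕ}

/-- Applying a layer of commuting complementary projections spreads the region `R s` that carries
energy to `R (s + 1)` only, and changes the vector only by an element of `K`. -/
theorem complProd_layer
    (hR : ∀ s, ∀ i ∈ R s, ∀ j ∉ R (s + 1), Commute (P i) (P j)) (hmono : Monotone R)
    (hK : ∀ s < N, ∀ i ∈ R s, ∀ v, P i v ∈ K) {l : List ι}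
    (hl : ∀ i ∈ l, ∀ j ∈ l, Commute (P i) (P j)) {s : ℕ} (hs : s < N) {v : V}
    (hv : v ∈ groundSpace P (R s)ᶜ) :
    complProd P l v ∈ groundSpace P (R (s + 1))ᶜ ∧ complProd P l v - v ∈ K := by
  rw [mem_groundSpace] at hv
  -- Terms of the layer outside `R s` keep annihilating the vector, since the layer commutes; their
  -- factors act as the identity. Only factors in `R s` change the vector, and these commute with
  -- every term outside `R (s + 1)`.
  have key : ∀ l' : List ι, l' ⊆ l →
      (∀ i ∈ l, i ∉ R s → P i (complProd P l' v) = 0) ∧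
      (∀ i, i ∉ R (s + 1) → P i (complProd P l' v) = 0) ∧ complProd P l' v - v ∈ K := by
    intro l'
    induction l' with
    | nil =>
      intro _
      refine ⟨fun i _ hi => by simpa using hv i hi, fun i hi => ?_, by simp⟩
      simpa using hv i fun h => hi (hmono (Nat.le_succ s) h)
    | cons k l' ih =>
      intro hsub
      obtain ⟨h1, h2, h3⟩ := ih fun x hx => hsub (List.mem_cons_of_mem _ hx)
      have hk : k ∈ l := hsub List.mem_cons_self
      set u := complProd P l' v with hu
      rw [complProd_cons, ← hu]
      by_cases hkR : k ∈ R s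
      · have hcomm : ∀ i, Commute (P i) (P k) → P i u = 0 → P i (u - P k u) = 0 := by
          intro i hc h0
          have h4 : P i (P k u) = P k (P i u) := LinearMap.congr_fun hc.eq u
          rw [map_sub, h4, h0, map_zero, sub_zero]
        refine ⟨fun i hi hiR => hcomm i (hl i hi k hk) (h1 i hi hiR),
          fun i hi => hcomm i (hR s k hkR i hi).symm (h2 i hi), ?_⟩
        rw [sub_right_comm]
        exact K.sub_mem h3 (hK s hs k hkR u)
      · rw [h1 k hk hkR, sub_zero]
        exact ⟨h1, h2, h3⟩
  obtain ⟨-, h2, h3⟩ := key l (List.Subset.refl l)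
  exact ⟨mem_groundSpace.2 h2, h3⟩

theorem complProd_layers
    (hR : ∀ s, ∀ i ∈ R s, ∀ j ∉ R (s + 1), Commute (P i) (P j)) (hmono : Monotone R)
    (hK : ∀ s < N, ∀ i ∈ R s, ∀ v, P i v ∈ K) (ls : List (List ι))
    (hl : ∀ l ∈ ls, ∀ i ∈ l, ∀ j ∈ l, Commute (P i) (P j)) {s : ℕ} (hs : s + ls.length ≤ N) {v : V}
    (hv : v ∈ groundSpace P (R s)ᶜ) :
    complProd P ls.flatten v ∈ groundSpace P (R (s + ls.length))ᶜ ∧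
      complProd P ls.flatten v - v ∈ K := by
  induction ls with
  | nil => simpa using hv
  | cons l ls ih =>
    rw [List.length_cons] at hs ⊢
    obtain ⟨h1, h2⟩ := ih (fun l hl' => hl l (List.mem_cons_of_mem _ hl')) (by omega)
    obtain ⟨h3, h4⟩ := complProd_layer hR hmono hK (hl l List.mem_cons_self)
      (show s + ls.length < N by omega) h1
    rw [List.flatten_cons, complProd_append]
    exact ⟨h3, by simpa using K.add_mem h4 h2⟩

theorem complProd_layers_pow
    (hR : ∀ s, ∀ i ∈ R s, ∀ j ∉ R (s + 1), Commute (P i) (P j)) (hmono : Monotone R)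
    (hK : ∀ s < N, ∀ i ∈ R s, ∀ v, P i v ∈ K) (ls : List (List ι))
    (hl : ∀ l ∈ ls, ∀ i ∈ l, ∀ j ∈ l, Commute (P i) (P j)) {q : ℕ} (hq : q * ls.length ≤ N) {v : V}
    (hv : v ∈ groundSpace P (R 0)ᶜ) :
    (complProd P ls.flatten ^ q) v ∈ groundSpace P (R (q * ls.length))ᶜ ∧
      (complProd P ls.flatten ^ q) v - v ∈ K := by
  induction q with
  | zero => simpa using hv
  | succ q ih =>
    rw [Nat.succ_mul] at hq ⊢
    obtain ⟨h1, h2⟩ := ih (by omega)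
    obtain ⟨h3, h4⟩ := complProd_layers hR hmono hK ls hl hq h1
    rw [pow_succ', Module.End.mul_apply]
    exact ⟨h3, by simpa using K.add_mem h4 h2⟩

end LightCone

end ProjectionFamily
-- Two nearly orthogonal projections
section TwoSubspaces

variable {V : Type*} [NormedAddCommGroup V] [InnerProductSpace ℂ V] [FiniteDimensional ℂ V]

theorem Submodule.norm_sub_starProjection_sq (U : Submodule ℂ V) (v : V) :
    ‖v - U.starProjection v‖ ^ 2 = ‖v‖ ^ 2 - ‖U.starProjection v‖ ^ 2 := by
  have h := U.norm_sq_eq_add_norm_sq_starProjection v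
  rw [Submodule.starProjection_orthogonal_val] at h
  linarith

/-- If `‖E F φ‖ ≤ ε ‖F φ‖` on the complement of a subspace `G` common to the ranges of the
orthogonal projections `E` and `F`, then `(1 - E) + (1 - F) ≥ 1 - ε` there. -/
theorem Submodule.mul_norm_sq_le_of_starProjection_comp_le {A B G : Submodule ℂ V} (hB : G ≤ B)
    {ε : ℝ} (h0 : 0 ≤ ε) (hε : ∀ φ ∈ Gᗮ, φ ∈ B → ‖A.starProjection φ‖ ≤ ε * ‖φ‖) {v : V} (hv : v ∈ Gᗮ) :
    (1 - ε) * ‖v‖ ^ 2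
      ≤ ‖v - A.starProjection v‖ ^ 2 + ‖v - B.starProjection v‖ ^ 2 := by
  rw [norm_sub_starProjection_sq, norm_sub_starProjection_sq]
  set a := A.starProjection v with ha
  set b := B.starProjection v with hb
  have hbG : b ∈ Gᗮ := by
    have h1 : v - b ∈ Gᗮ := Submodule.orthogonal_le hB (B.sub_starProjection_mem_orthogonal v)
    simpa using Gᗮ.sub_mem hv h1
  have hbB : b ∈ B := B.starProjection_apply_mem v
  have hav : (inner ℂ v a).re = ‖a‖ ^ 2 := by
    have := A.starProjection_inner_eq_zero v a (A.starProjection_apply_mem v)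
    rw [inner_sub_left, sub_eq_zero] at this
    rw [this, inner_self_eq_norm_sq_to_K]
    norm_cast
  have hbv : (inner ℂ v b).re = ‖b‖ ^ 2 := by
    have := B.starProjection_inner_eq_zero v b hbB
    rw [inner_sub_left, sub_eq_zero] at this
    rw [this, inner_self_eq_norm_sq_to_K]
    norm_cast
  have hab : (inner ℂ a b).re ≤ ε * (‖a‖ * ‖b‖) := by
    have h1 : inner ℂ a b = inner ℂ a (A.starProjection b) := by
      rw [← A.inner_starProjection_left_eq_right a b,
        Submodule.starProjection_eq_self_iff.2 (A.starProjection_apply_mem v)]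
    rw [h1]
    calc (inner ℂ a (A.starProjection b)).re ≤ ‖a‖ * ‖A.starProjection b‖ :=
          re_inner_le_norm (𝕜 := ℂ) _ _
      _ ≤ ‖a‖ * (ε * ‖b‖) := by
          gcongr
          exact hε b hbG hbB
      _ = _ := by ring
  -- Here `s = Re ⟪v, a + b⟫ ≤ ‖v‖ ‖a + b‖` and `‖a + b‖² ≤ (1 + ε) s`, hence `s ≤ (1 + ε) ‖v‖²`.
  set s := ‖a‖ ^ 2 + ‖b‖ ^ 2 with hs
  have h1 : s ≤ ‖v‖ * ‖a + b‖ := by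
    have := re_inner_le_norm (𝕜 := ℂ) v (a + b)
    rw [inner_add_right, map_add, RCLike.re_to_complex, RCLike.re_to_complex, hav, hbv] at this
    exact this
  have h2 : ‖a + b‖ ^ 2 ≤ s + 2 * (ε * (‖a‖ * ‖b‖)) := by
    rw [@norm_add_sq ℂ, RCLike.re_to_complex]
    linarith
  have h3 : ‖a + b‖ ^ 2 ≤ (1 + ε) * s := by
    nlinarith [mul_nonneg h0 (sq_nonneg (‖a‖ - ‖b‖))]
  have hs0 : 0 ≤ s := by positivity
  rcases hs0.eq_or_lt with h | h
  · nlinarith [sq_nonneg ‖v‖]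
  · have h4 : s * s ≤ (‖v‖ ^ 2 * (1 + ε)) * s := by
      calc s * s ≤ (‖v‖ * ‖a + b‖) * (‖v‖ * ‖a + b‖) := by gcongr
        _ = ‖v‖ ^ 2 * ‖a + b‖ ^ 2 := by ring
        _ ≤ ‖v‖ ^ 2 * ((1 + ε) * s) := by gcongr
        _ = _ := by ring
    have := le_of_mul_le_mul_right h4 h
    linarith

end TwoSubspaces

/-! ### Polynomial contraction and comparison of two subfamilies -/

namespace ProjectionFamily

variable {V : Type*} [NormedAddCommGroup V] [InnerProductSpace ℂ V]

/-- The coefficients of `p` sum to `p(1) = 1`, so `p(T)v - v` is a combination of the vectors `T^i v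
- v`. -/
theorem aeval_apply_sub_mem {T : V →ₗ[ℂ] V} {K : Submodule ℂ V} {v : V} {q : ℕ}
    (hT : ∀ j ≤ q, (T ^ j) v - v ∈ K) {p : ℂ[X]} (hp : p.natDegree ≤ q) (h1 : p.eval 1 = 1) :
    aeval T p v - v ∈ K := by
  have h2 : aeval T p v - v = ∑ i ∈ Finset.range (q + 1), p.coeff i • ((T ^ i) v - v) := by
    rw [aeval_eq_sum_range' (Nat.lt_succ_of_le hp)]
    rw [eval_eq_sum_range' (Nat.lt_succ_of_le hp)] at h1
    simp only [one_pow, mul_one] at h1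
    simp only [smul_sub, Finset.sum_sub_distrib, ← Finset.sum_smul, h1, one_smul,
      LinearMap.sum_apply, LinearMap.smul_apply]
  rw [h2]
  exact K.sum_mem fun i hi => K.smul_mem _ (hT i (Nat.lt_succ_iff.1 (Finset.mem_range.1 hi)))

theorem apply_mem_groundSpace_orthogonal {ι : Type*} {P : ι → V →ₗ[ℂ] V}
    (hP : ∀ i, (P i).IsSymmetricProjection) {S : Set ι} {i : ι} (hi : i ∈ S) (v : V) :
    P i v ∈ (groundSpace P S)ᗮ := by
  rw [Submodule.mem_orthogonal]
  intro u hu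
  rw [← (hP i).isSymmetric, mem_groundSpace.1 hu i hi, inner_zero_left]

/-- Every term of `S` annihilates the projected part, so removing it leaves the energy unchanged. -/
theorem mul_norm_sub_starProjection_sq_le [FiniteDimensional ℂ V] {ι : Type*}
    {P : ι → V →ₗ[ℂ] V} {S : Finset ι} {Γ : ℝ}
    (hΓ : ∀ v ∈ (groundSpace P (S : Set ι))ᗮ, Γ * ‖v‖ ^ 2 ≤ ∑ i ∈ S, ‖P i v‖ ^ 2) (v : V) :
    Γ * ‖v - (groundSpace P (S : Set ι)).starProjection v‖ ^ 2 ≤ ∑ i ∈ S, ‖P i v‖ ^ 2 := by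
  refine (hΓ _ (Submodule.sub_starProjection_mem_orthogonal v)).trans (le_of_eq ?_)
  refine Finset.sum_congr rfl fun i hi => ?_
  rw [map_sub, mem_groundSpace.1 (Submodule.starProjection_apply_mem _ v) i hi, sub_zero]

variable [FiniteDimensional ℂ V] {ι : Type*} [Fintype ι]
  {P : ι → V →ₗ[ℂ] V} (hP : ∀ i, (P i).IsSymmetricProjection)
include hP

open Classical in
/-- The Chebyshev polynomial of the squared detectability-lemma operator contracts the complement
of the ground space. -/
theorem exists_polynomial_contraction {g : ℕ}
    (hg : ∀ i, (Finset.univ.filter fun j => j ≠ i ∧ ¬ Commute (P i) (P j)).card ≤ g)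
    {l : List ι} (hl : l.Nodup) (hmem : ∀ i, i ∈ l) {γ : ℝ} (hγ0 : 0 < γ) (hg0 : 0 < g)
    (hγ : ∀ v ∈ (groundSpace P Set.univ)ᗮ, γ * ‖v‖ ^ 2 ≤ ∑ i, ‖P i v‖ ^ 2) (q : ℕ) :
    ∃ p : ℂ[X], p.natDegree ≤ q ∧ p.eval 1 = 1 ∧ ∀ v ∈ (groundSpace P Set.univ)ᗮ,
      ‖aeval (complProd P (l.reverse ++ l)) p v‖
        ≤ (1 + (q : ℝ) ^ 2 * (2 * γ / (g : ℝ) ^ 2))⁻¹ * ‖v‖ := by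
  set T := complProd P (l.reverse ++ l)
  set δ : ℝ := 2 * γ / (g : ℝ) ^ 2 with hδ
  have hgpos : (0 : ℝ) < (g : ℝ) ^ 2 := by positivity
  have hδ0 : 0 ≤ δ := by positivity
  set τ : ℝ := (Chebyshev.T ℝ q).eval (1 + δ) with hτ
  have hτ1 : 1 + (q : ℝ) ^ 2 * δ ≤ τ := one_add_sq_mul_le_eval_chebyshev_T hδ0 q
  have hτ0 : 0 < τ := lt_of_lt_of_le (by positivity) hτ1
  -- The affine map `(2 + δ)X - 1` sends `[0, g²/(g² + γ)] = [0, 2/(2 + δ)]` onto `[-1, 1]`, and `1`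
  -- to `1 + δ`.
  set pr : ℝ[X] := C τ⁻¹ * (Chebyshev.T ℝ q).comp (C (2 + δ) * X - C 1) with hpr
  have hTsym : T.IsSymmetric := fun u v => by
    have := inner_complProd hP (l.reverse ++ l) u v
    rwa [List.reverse_append, List.reverse_reverse] at this
  have hTin : ∀ v, inner ℂ v (T v) = ((‖complProd P l v‖ ^ 2 : ℝ) : ℂ) := by
    intro v
    rw [show T v = complProd P l.reverse (complProd P l v) from complProd_append P _ _ v,
      ← inner_complProd hP, inner_self_eq_norm_sq_to_K]
    norm_cast
  refine ⟨pr.map (algebraMap ℝ ℂ), ?_, ?_, ?_⟩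
  · refine natDegree_map_le.trans ((natDegree_C_mul_le _ _).trans (natDegree_comp_le.trans ?_))
    have h1 : (Chebyshev.T ℝ q).natDegree = q := by
      rw [Chebyshev.natDegree_T]
      simp
    have h2 : (C (2 + δ) * X - C 1 : ℝ[X]).natDegree ≤ 1 := by compute_degree
    rw [h1]
    nlinarith
  · have h1 : pr.eval 1 = 1 := by
      rw [hpr]
      simp only [eval_mul, eval_C, eval_comp, eval_sub, eval_X, mul_one]
      rw [show 2 + δ - 1 = 1 + δ by ring, ← hτ, inv_mul_cancel₀ hτ0.ne']
    have h2 := eval₂_at_apply (p := pr) (algebraMap ℝ ℂ) 1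
    rw [h1] at h2
    simpa [eval_map] using h2
  · intro v hv
    refine (hTsym.norm_aeval_apply_le pr v (C := τ⁻¹) ?_ (by positivity)).trans ?_
    · intro μ e he hev
      have hμe : μ * ‖e‖ ^ 2 = ‖complProd P l e‖ ^ 2 := by
        have := hTin e
        rw [he, inner_smul_right, inner_self_eq_norm_sq_to_K] at this
        exact Complex.ofReal_injective (by push_cast; simpa using this)
      have he0 : 0 < ‖e‖ ^ 2 := by
        have : e ≠ 0 := by rintro rfl; simp at hev
        positivity
      have hμ0 : 0 ≤ μ := by
        by_contra! h
        nlinarith [sq_nonneg ‖complProd P l e‖]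
      -- the part of `e` orthogonal to the ground space is again an eigenvector
      have hμ1 : (2 + δ) * μ ≤ 2 := by
        set G := groundSpace P Set.univ
        set a := G.starProjection e with ha
        have haG : a ∈ G := G.starProjection_apply_mem e
        have hbG : e - a ∈ Gᗮ := G.sub_starProjection_mem_orthogonal e
        have hTa : T a = a := complProd_of_mem_groundSpace haG _
        have hTb : T (e - a) ∈ Gᗮ := complProd_mem_orthogonal hP _ hbG
        have hTb' : T (e - a) = (μ : ℂ) • (e - a) := by
          have h1 : T (e - a) - (μ : ℂ) • (e - a) = (μ : ℂ) • a - a := by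
            rw [map_sub, he, hTa, smul_sub]
            abel
          have h2 : T (e - a) - (μ : ℂ) • (e - a) ∈ Gᗮ := Gᗮ.sub_mem hTb (Gᗮ.smul_mem _ hbG)
          have h3 : T (e - a) - (μ : ℂ) • (e - a) ∈ G := by
            rw [h1]
            exact G.sub_mem (G.smul_mem _ haG) haG
          have h4 := Submodule.inner_right_of_mem_orthogonal h3 h2
          exact sub_eq_zero.1 (inner_self_eq_zero.1 h4)
        have hb0 : e - a ≠ 0 := by
          intro h
          rw [sub_eq_zero] at h
          rw [h] at hev
          exact hev (Submodule.inner_right_of_mem_orthogonal haG hv)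
        have hbpos : 0 < ‖e - a‖ ^ 2 := by
          have := norm_pos_iff.2 hb0
          positivity
        have hμb : μ * ‖e - a‖ ^ 2 = ‖complProd P l (e - a)‖ ^ 2 := by
          have := hTin (e - a)
          rw [hTb', inner_smul_right, inner_self_eq_norm_sq_to_K] at this
          exact Complex.ofReal_injective (by push_cast; simpa using this)
        have hdl := detectability_lemma hP hg hl hmem hγ hbG
        rw [← hμb, ← mul_assoc] at hdl
        have h5 := le_of_mul_le_mul_right hdl hbpos
        have h6 : δ * (g : ℝ) ^ 2 = 2 * γ := by
          rw [hδ]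
          field_simp
        refine le_of_mul_le_mul_right ?_ hgpos
        calc (2 + δ) * μ * (g : ℝ) ^ 2 = 2 * (g : ℝ) ^ 2 * μ + δ * (g : ℝ) ^ 2 * μ := by ring
          _ = 2 * (((g : ℝ) ^ 2 + γ) * μ) := by rw [h6]; ring
          _ ≤ 2 * (g : ℝ) ^ 2 := by linarith
      have h7 : |(Chebyshev.T ℝ q).eval ((2 + δ) * μ - 1)| ≤ 1 := by
        refine Chebyshev.abs_eval_T_real_le_one _ (abs_le.2 ⟨?_, by linarith⟩)
        have : 0 ≤ (2 + δ) * μ := by positivity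
        linarith
      rw [hpr]
      simp only [eval_mul, eval_C, eval_comp, eval_sub, eval_X]
      rw [abs_mul, abs_of_pos (inv_pos.2 hτ0)]
      exact mul_le_of_le_one_right (by positivity) h7
    · gcongr

open Classical in
/-- The gap of a frustration-free family of projections bounds the gap of two subfamilies `A`, `B`
whose fattened complements are covered by each other. -/
theorem subfamily_gap_le {g L q : ℕ} (hq : 0 < q)
    (hg : ∀ i, (Finset.univ.filter fun j => j ≠ i ∧ ¬ Commute (P i) (P j)).card ≤ g)
    (layer : ι → Fin L) (hlayer : ∀ i j, layer i = layer j → Commute (P i) (P j))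
    {R : ℕ → Set ι} (hR : ∀ s, ∀ i ∈ R s, ∀ j ∉ R (s + 1), Commute (P i) (P j))
    (hmono : Monotone R) {A B : Finset ι} (hB : ∀ i ∉ R 0, i ∈ B ∨ P i = 0)
    (hA : ∀ s < 2 * L * q, ∀ i ∈ R s, i ∈ A) {γ Γ : ℝ} (hγ0 : 0 < γ) (hg0 : 0 < g) (hΓ0 : 0 ≤ Γ)
    (hγ : ∀ v ∈ (groundSpace P Set.univ)ᗮ, γ * ‖v‖ ^ 2 ≤ ∑ i, ‖P i v‖ ^ 2)
    {ψ : V} (hψ : ψ ∈ (groundSpace P Set.univ)ᗮ) (hψ0 : ψ ≠ 0)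
    (hψγ : ∑ i, ‖P i ψ‖ ^ 2 ≤ γ * ‖ψ‖ ^ 2)
    (hΓA : ∀ v ∈ (groundSpace P (A : Set ι))ᗮ, Γ * ‖v‖ ^ 2 ≤ ∑ i ∈ A, ‖P i v‖ ^ 2)
    (hΓB : ∀ v ∈ (groundSpace P (B : Set ι))ᗮ, Γ * ‖v‖ ^ 2 ≤ ∑ i ∈ B, ‖P i v‖ ^ 2) :
    Γ ≤ 2 * γ + (g : ℝ) ^ 2 / (q : ℝ) ^ 2 := by
  set ls : List (List ι) :=
    (List.finRange L).map fun k => (Finset.univ.filter fun i => layer i = k).toList with hls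
  have hlayers : ∀ l ∈ ls, ∀ i ∈ l, ∀ j ∈ l, Commute (P i) (P j) := by
    intro l hl i hi j hj
    obtain ⟨k, -, rfl⟩ := List.mem_map.1 hl
    simp only [Finset.mem_toList, Finset.mem_filter, Finset.mem_univ, true_and] at hi hj
    exact hlayer i j (hi.trans hj.symm)
  have hmem : ∀ i, i ∈ ls.flatten := fun i => by
    simp [hls]
  have hnodup : ls.flatten.Nodup := by
    rw [List.nodup_flatten]
    refine ⟨?_, ?_⟩
    · intro l hl
      obtain ⟨k, -, rfl⟩ := List.mem_map.1 hl
      exact Finset.nodup_toList _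
    · rw [hls, List.pairwise_map]
      refine (List.nodup_finRange L).imp fun {a b} hab => ?_
      intro i hi hj
      simp only [Finset.mem_toList, Finset.mem_filter, Finset.mem_univ, true_and] at hi hj
      exact hab (hi.symm.trans hj)
  obtain ⟨p, hpd, hp1, hpc⟩ := exists_polynomial_contraction hP hg hnodup hmem hγ0 hg0 hγ q
  set GA := groundSpace P (A : Set ι)
  set GB := groundSpace P (B : Set ι)
  set G := groundSpace P Set.univ
  -- The layers of `D†D`: `2L` of them, so the powers up to `q` pass through at most `2Lq` layers.
  set ls' : List (List ι) := (ls.map List.reverse).reverse ++ ls with hls'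
  have hflat : ls'.flatten = ls.flatten.reverse ++ ls.flatten := by
    rw [hls', List.flatten_append, List.reverse_flatten]
  have hlen : ls'.length = 2 * L := by
    simp [hls', hls]
    ring
  have hlayers' : ∀ l ∈ ls', ∀ i ∈ l, ∀ j ∈ l, Commute (P i) (P j) := by
    intro l hl
    rw [hls', List.mem_append, List.mem_reverse, List.mem_map] at hl
    rcases hl with ⟨l', hl', rfl⟩ | hl
    · intro i hi j hj
      exact hlayers l' hl' i (List.mem_reverse.1 hi) j (List.mem_reverse.1 hj)
    · exact hlayers l hl
  set x : ℝ := (q : ℝ) ^ 2 * (2 * γ / (g : ℝ) ^ 2) with hx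
  have hgpos : (0 : ℝ) < (g : ℝ) ^ 2 := by positivity
  have hqpos : (0 : ℝ) < (q : ℝ) ^ 2 := by positivity
  have hxpos : 0 < x := by positivity
  have hε : ∀ φ ∈ Gᗮ, φ ∈ GB → ‖GA.starProjection φ‖ ≤ (1 + x)⁻¹ * ‖φ‖ := by
    intro φ hφ hφB
    have hφ0 : φ ∈ groundSpace P (R 0)ᶜ := by
      rw [mem_groundSpace] at hφB ⊢
      intro i hi
      rcases hB i hi with h | h
      · exact hφB i h
      · simp [h]
    have hKA : ∀ s < 2 * L * q, ∀ i ∈ R s, ∀ v, P i v ∈ GAᗮ := fun s hs i hi v =>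
      apply_mem_groundSpace_orthogonal hP (hA s hs i hi) v
    have hdiff := aeval_apply_sub_mem (T := complProd P ls'.flatten) (K := GAᗮ) (v := φ)
      (fun j hj => (complProd_layers_pow hR hmono hKA ls' hlayers' (q := j)
        (by rw [hlen, mul_comm]; exact Nat.mul_le_mul_left _ hj) hφ0).2) hpd hp1
    rw [hflat] at hdiff
    have heq := (Submodule.starProjection_apply_eq_zero_iff GA).2 hdiff
    rw [map_sub, sub_eq_zero] at heq
    rw [← heq]
    exact (GA.norm_starProjection_apply_le _).trans (hpc φ hφ)
  have hmain := Submodule.mul_norm_sq_le_of_starProjection_comp_le (A := GA) (B := GB)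
    (groundSpace_anti P (Set.subset_univ _)) (by positivity) hε hψ
  have hA1 := mul_norm_sub_starProjection_sq_le hΓA ψ
  have hB1 := mul_norm_sub_starProjection_sq_le hΓB ψ
  have hA2 : ∑ i ∈ A, ‖P i ψ‖ ^ 2 ≤ ∑ i, ‖P i ψ‖ ^ 2 :=
    Finset.sum_le_univ_sum_of_nonneg fun i => sq_nonneg _
  have hB2 : ∑ i ∈ B, ‖P i ψ‖ ^ 2 ≤ ∑ i, ‖P i ψ‖ ^ 2 :=
    Finset.sum_le_univ_sum_of_nonneg fun i => sq_nonneg _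
  have hψpos : 0 < ‖ψ‖ ^ 2 := by
    have := norm_pos_iff.2 hψ0
    positivity
  have h1 : Γ * (1 - (1 + x)⁻¹) ≤ 2 * γ := by
    refine le_of_mul_le_mul_right ?_ hψpos
    have := mul_le_mul_of_nonneg_left hmain hΓ0
    linarith
  have h2 : 1 - (1 + x)⁻¹ = x / (1 + x) := by
    field_simp
    ring
  -- With this identity `Γ x ≤ 2γ(1 + x)` becomes the claim multiplied by `x`.
  have h3 : (g : ℝ) ^ 2 / (q : ℝ) ^ 2 * x = 2 * γ := by
    rw [hx]
    field_simp
  rw [h2, mul_div_assoc', div_le_iff₀ (by positivity)] at h1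
  refine le_of_mul_le_mul_right ?_ hxpos
  linarith

end ProjectionFamily

/-! ### Gaps of families of commuting blocks -/

namespace ProjectionFamily

variable {V : Type*} [NormedAddCommGroup V] [InnerProductSpace ℂ V]
  {ι : Type*} {P : ι → V →ₗ[ℂ] V} (hP : ∀ i, (P i).IsSymmetricProjection)
include hP

theorem re_inner_sum_apply (S : Finset ι) (v : V) :
    (inner ℂ v ((∑ i ∈ S, P i) v)).re = ∑ i ∈ S, ‖P i v‖ ^ 2 := by
  simp_rw [LinearMap.sum_apply, inner_sum, Complex.re_sum, re_inner_apply hP]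

theorem isSymmetric_sum (S : Finset ι) : (∑ i ∈ S, P i).IsSymmetric :=
  LinearMap.isSymmetric_sum S fun i _ => (hP i).isSymmetric

theorem sum_apply_eq_zero_iff (S : Finset ι) (v : V) :
    (∑ i ∈ S, P i) v = 0 ↔ v ∈ groundSpace P (S : Set ι) := by
  rw [mem_groundSpace]
  constructor
  · intro h i hi
    have h1 := re_inner_sum_apply hP S v
    rw [h, inner_zero_right, Complex.zero_re, eq_comm,
      Finset.sum_eq_zero_iff_of_nonneg fun i _ => sq_nonneg _] at h1
    simpa using h1 i hi
  · intro h
    rw [LinearMap.sum_apply]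
    exact Finset.sum_eq_zero h

/-- The product of two commuting projections is again a projection. -/
theorem re_inner_apply_apply_nonneg {i j : ι} (h : Commute (P i) (P j)) (v : V) :
    0 ≤ (inner ℂ (P i v) (P j v)).re := by
  have h1 : inner ℂ (P i v) (P j v) = inner ℂ (P j (P i v)) (P j (P i v)) := by
    have h2 : P i (P j v) = P j (P i v) := LinearMap.congr_fun h.eq v
    rw [(hP j).isSymmetric, apply_apply hP, (hP i).isSymmetric, (hP i).isSymmetric, ← h2,
      apply_apply hP]
  rw [h1]
  exact inner_self_nonneg (𝕜 := ℂ)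

/-- The gap in the form `Γ h ≤ h²`, which, unlike a statement about eigenvalues, can be summed over
commuting blocks. -/
theorem mul_norm_sq_le_of_spectrum [FiniteDimensional ℂ V] {S : Finset ι} {Γ : ℝ}
    (hΓ : ∀ (μ : ℝ) (e : V), e ≠ 0 → (∑ i ∈ S, P i) e = (μ : ℂ) • e → μ ≠ 0 → Γ ≤ μ) (v : V) :
    Γ * ∑ i ∈ S, ‖P i v‖ ^ 2 ≤ ‖(∑ i ∈ S, P i) v‖ ^ 2 := by
  rw [← re_inner_sum_apply hP]
  refine (isSymmetric_sum hP S).mul_re_inner_le_norm_sq (fun u => ?_) hΓ v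
  rw [re_inner_sum_apply hP]
  positivity

theorem mul_norm_sq_le_sum [FiniteDimensional ℂ V] {S : Finset ι} {Γ : ℝ}
    (hΓ : ∀ v, Γ * ∑ i ∈ S, ‖P i v‖ ^ 2 ≤ ‖(∑ i ∈ S, P i) v‖ ^ 2)
    {v : V} (hv : v ∈ (groundSpace P (S : Set ι))ᗮ) : Γ * ‖v‖ ^ 2 ≤ ∑ i ∈ S, ‖P i v‖ ^ 2 := by
  rw [← re_inner_sum_apply hP]
  refine (isSymmetric_sum hP S).mul_norm_sq_le_re_inner (fun u => ?_) (fun u => ?_) fun u hu => ?_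
  · rw [re_inner_sum_apply hP]
    positivity
  · rw [re_inner_sum_apply hP]
    exact hΓ u
  · exact Submodule.inner_right_of_mem_orthogonal ((sum_apply_eq_zero_iff hP S u).1 hu) hv

/-- Mutually commuting blocks inherit the smallest of their spectral gaps. -/
theorem mul_norm_sq_le_biUnion [FiniteDimensional ℂ V] [DecidableEq ι] {κ : Type*} (J : Finset κ)
    (S : κ → Finset ι) (hdisj : ∀ a ∈ J, ∀ b ∈ J, a ≠ b → Disjoint (S a) (S b))
    (hcomm : ∀ a ∈ J, ∀ b ∈ J, a ≠ b → ∀ i ∈ S a, ∀ j ∈ S b, Commute (P i) (P j)) {Γ : ℝ}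
    (hΓ : ∀ a ∈ J, ∀ (μ : ℝ) (e : V), e ≠ 0 → (∑ i ∈ S a, P i) e = (μ : ℂ) • e → μ ≠ 0 → Γ ≤ μ)
    {v : V} (hv : v ∈ (groundSpace P (J.biUnion S : Set ι))ᗮ) :
    Γ * ‖v‖ ^ 2 ≤ ∑ i ∈ J.biUnion S, ‖P i v‖ ^ 2 := by
  -- It suffices that `Γ ∑ h_a ≤ (∑ h_a)²`. The diagonal terms give `Γ h_a ≤ h_a²`, and the cross
  -- terms are sums of products of commuting projections, hence nonnegative.
  refine mul_norm_sq_le_sum hP (fun u => ?_) hv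
  have hd : (J : Set κ).PairwiseDisjoint S := fun a ha b hb hab => hdisj a ha b hb hab
  rw [Finset.sum_biUnion hd, Finset.sum_biUnion hd, Finset.mul_sum]
  set h : κ → V := fun a => (∑ i ∈ S a, P i) u with hh
  have h1 : (∑ a ∈ J, ∑ i ∈ S a, P i) u = ∑ a ∈ J, h a := by
    rw [LinearMap.sum_apply]
  have h2 : ‖∑ a ∈ J, h a‖ ^ 2 = ∑ a ∈ J, ∑ b ∈ J, (inner ℂ (h a) (h b)).re := by
    have : ((‖∑ a ∈ J, h a‖ ^ 2 : ℝ) : ℂ) = inner ℂ (∑ a ∈ J, h a) (∑ a ∈ J, h a) := by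
      rw [inner_self_eq_norm_sq_to_K]
      norm_cast
    rw [← Complex.ofReal_re (‖∑ a ∈ J, h a‖ ^ 2), this, sum_inner, Complex.re_sum]
    simp_rw [inner_sum, Complex.re_sum]
  rw [h1, h2]
  refine Finset.sum_le_sum fun a ha => ?_
  have h3 : Γ * ∑ i ∈ S a, ‖P i u‖ ^ 2 ≤ (inner ℂ (h a) (h a)).re := by
    refine (mul_norm_sq_le_of_spectrum hP (hΓ a ha) u).trans (le_of_eq ?_)
    rw [inner_self_eq_norm_sq_to_K]
    norm_cast
  refine h3.trans (Finset.single_le_sum (f := fun b => (inner ℂ (h a) (h b)).re) (fun b hb => ?_) ha)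
  rcases eq_or_ne a b with rfl | hab
  · exact inner_self_nonneg (𝕜 := ℂ)
  · simp only [hh, LinearMap.sum_apply, sum_inner, inner_sum, Complex.re_sum]
    exact Finset.sum_nonneg fun i hi => Finset.sum_nonneg fun j hj =>
      re_inner_apply_apply_nonneg hP (hcomm a ha b hb hab _ hj _ hi) u

open Classical in
/-- The comparison of the global gap `γ` with a lower bound `Γ` on the gaps of two families of
blocks, each consisting of pairwise commuting blocks, such that the complement of the blocks `S'`
stays inside the blocks `S` when fattened `2 L q` times. -/
theorem le_of_commuting_blocks [FiniteDimensional ℂ V] [Fintype ι] {g L q : ℕ} (hq : 0 < q)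
    (hg : ∀ i, (Finset.univ.filter fun j => j ≠ i ∧ ¬ Commute (P i) (P j)).card ≤ g)
    (layer : ι → Fin L) (hlayer : ∀ i j, layer i = layer j → Commute (P i) (P j))
    {γ : ℝ} (hγ : ∀ (μ : ℝ) (e : V), e ≠ 0 → (∑ i, P i) e = (μ : ℂ) • e → μ ≠ 0 → γ ≤ μ)
    {ψ : V} (hψ0 : ψ ≠ 0) (hψ : (∑ i, P i) ψ = (γ : ℂ) • ψ) (hγ0 : γ ≠ 0)
    (hγg : γ ≤ (g : ℝ) ^ 2 / 4) {κ : Type*} (J J' : Finset κ) (S S' : κ → Finset ι)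
    (hS : ∀ a ∈ J, ∀ b ∈ J, a ≠ b → Disjoint (S a) (S b))
    (hSc : ∀ a ∈ J, ∀ b ∈ J, a ≠ b → ∀ i ∈ S a, ∀ j ∈ S b, Commute (P i) (P j))
    (hS' : ∀ a ∈ J', ∀ b ∈ J', a ≠ b → Disjoint (S' a) (S' b))
    (hSc' : ∀ a ∈ J', ∀ b ∈ J', a ≠ b → ∀ i ∈ S' a, ∀ j ∈ S' b, Commute (P i) (P j))
    {R : ℕ → Set ι} (hmono : Monotone R)
    (hR : ∀ s, ∀ i ∈ R s, ∀ j ∉ R (s + 1), Commute (P i) (P j))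
    (hRS' : ∀ i ∉ R 0, (∃ a ∈ J', i ∈ S' a) ∨ P i = 0)
    (hRS : ∀ s < 2 * L * q, ∀ i ∈ R s, ∃ a ∈ J, i ∈ S a) {Γ : ℝ} (hΓ0 : 0 ≤ Γ)
    (hΓ : ∀ a ∈ J, ∀ (μ : ℝ) (e : V), e ≠ 0 → (∑ i ∈ S a, P i) e = (μ : ℂ) • e → μ ≠ 0 → Γ ≤ μ)
    (hΓ' : ∀ a ∈ J', ∀ (μ : ℝ) (e : V), e ≠ 0 → (∑ i ∈ S' a, P i) e = (μ : ℂ) • e → μ ≠ 0 →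
      Γ ≤ μ) :
    Γ ≤ 2 * γ + (g : ℝ) ^ 2 / (q : ℝ) ^ 2 := by
  have hψsum : ∑ i, ‖P i ψ‖ ^ 2 = γ * ‖ψ‖ ^ 2 := by
    rw [← re_inner_sum_apply hP, hψ, inner_smul_right, Complex.re_ofReal_mul,
      inner_self_eq_norm_sq_to_K]
    norm_cast
  have hψpos : 0 < ‖ψ‖ ^ 2 := by
    have := norm_pos_iff.2 hψ0
    positivity
  have hγpos : 0 < γ := by
    refine lt_of_le_of_ne ?_ (Ne.symm hγ0)
    by_contra! h
    have : 0 ≤ ∑ i, ‖P i ψ‖ ^ 2 := by positivity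
    nlinarith
  -- `g = 0` would force `γ ≤ 0`.
  have hgpos : 0 < g := by
    rcases Nat.eq_zero_or_pos g with h | h
    · rw [h] at hγg
      norm_num at hγg
      linarith
    · exact h
  have hψorth : ψ ∈ (groundSpace P Set.univ)ᗮ := by
    rw [Submodule.mem_orthogonal]
    intro u hu
    rw [← Finset.coe_univ, ← sum_apply_eq_zero_iff hP] at hu
    have h1 : inner ℂ u ((∑ i, P i) ψ) = 0 := by
      rw [← isSymmetric_sum hP, hu, inner_zero_left]
    rw [hψ, inner_smul_right] at h1
    exact (mul_eq_zero.1 h1).resolve_left (by exact_mod_cast hγ0)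
  refine subfamily_gap_le hP (L := L) hq hg layer hlayer hR hmono (A := J.biUnion S)
    (B := J'.biUnion S') ?_ ?_ hγpos hgpos hΓ0 ?_ hψorth hψ0 hψsum.le
    (fun v hv => mul_norm_sq_le_biUnion hP J S hS hSc hΓ hv)
    (fun v hv => mul_norm_sq_le_biUnion hP J' S' hS' hSc' hΓ' hv)
  · exact fun i hi => (hRS' i hi).imp_left Finset.mem_biUnion.2
  · exact fun s hs i hi => Finset.mem_biUnion.2 (hRS s hs i hi)
  · exact fun v hv => mul_norm_sq_le_sum hP (mul_norm_sq_le_of_spectrum hP hγ) (by simpa using hv)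

end ProjectionFamily

/-! ### Supports of operators and the spectral gap -/

namespace QuditChain

theorem SupportedOn.commute {n : ℕ} {d : Fin n → ℕ} {S S' : Finset (Fin n)} {A B : Op d}
    (hA : SupportedOn S A) (hB : SupportedOn S' B) (h : Disjoint S S') : Commute A B := by
  obtain ⟨a, ha⟩ := hA
  obtain ⟨b, hb⟩ := hB
  have key : ∀ (S S' : Finset (Fin n)) (A B : Op d)
      (a : Matrix (∀ i : S, Fin (d i)) (∀ i : S, Fin (d i)) ℂ)
      (b : Matrix (∀ i : S', Fin (d i)) (∀ i : S', Fin (d i)) ℂ), Disjoint S S' →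
      (∀ x y : Config d,
        A x y = if ∀ i, i ∉ S → x i = y i then a (fun i => x i) (fun i => y i) else 0) →
      (∀ x y : Config d,
        B x y = if ∀ i, i ∉ S' → x i = y i then b (fun i => x i) (fun i => y i) else 0) →
      ∀ x y : Config d, (A * B) x y =
        if ∀ i, i ∉ S → i ∉ S' → x i = y i then
          a (fun i => x i) (fun i => y i) * b (fun i => x i) (fun i => y i) else 0 := by
    intro S S' A B a b hd ha hb x y
    rw [Finset.disjoint_left] at hd
    -- The only intermediate configuration that can contribute to `(A * B) x y`: `A` changes `x`
    -- only on `S`, and `B` leaves `S` untouched. The resulting entry is symmetric in the two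
    -- factors.
    set z : Config d := fun i => if i ∈ S then y i else x i with hz
    have hzS : ∀ i ∈ S, z i = y i := fun i hi => by simp [hz, hi]
    have hzS' : ∀ i, i ∉ S → z i = x i := fun i hi => by simp [hz, hi]
    rw [Matrix.mul_apply, Finset.sum_eq_single z]
    · rw [ha, hb, if_pos fun i hi => (hzS' i hi).symm]
      have h1 : (fun i : S => z i) = fun i : S => y i := funext fun i => hzS i i.2
      have h2 : (fun i : S' => z i) = fun i : S' => x i :=
        funext fun i => hzS' i fun hi => hd hi i.2
      rw [h1, h2]
      by_cases hxy : ∀ i, i ∉ S → i ∉ S' → x i = y i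
      · rw [if_pos hxy, if_pos]
        intro i hi
        by_cases hiS : i ∈ S
        · exact hzS i hiS
        · rw [hzS' i hiS, hxy i hiS hi]
      · rw [if_neg hxy, if_neg, mul_zero]
        intro hc
        exact hxy fun i hi hi' => by rw [← hzS' i hi, hc i hi']
    · intro w _ hw
      rw [ha, hb]
      by_contra hne
      refine hw (funext fun i => ?_)
      by_cases h1 : ∀ i, i ∉ S → x i = w i
      · by_cases h2 : ∀ i, i ∉ S' → w i = y i
        · by_cases hiS : i ∈ S
          · rw [hzS i hiS, h2 i (hd hiS)]
          · rw [hzS' i hiS, h1 i hiS]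
        · simp [h2] at hne
      · simp [h1] at hne
    · simp
  refine Matrix.ext fun x y => ?_
  rw [key S S' A B a b h ha hb, key S' S B A b a h.symm hb ha]
  simp_rw [mul_comm (b _ _)]
  congr 1
  exact propext ⟨fun h i h1 h2 => h i h2 h1, fun h i h1 h2 => h i h2 h1⟩

section Gap

variable {n : ℕ} {d : Fin n → ℕ}

theorem mem_eigenvalues_iff {A : Op d} {μ : ℝ} :
    μ ∈ eigenvalues A ↔ ∃ e, e ≠ 0 ∧ Matrix.toEuclideanLin A e = (μ : ℂ) • e := by
  rw [eigenvalues, Set.mem_ofPred_eq, Module.End.hasEigenvalue_iff, Submodule.ne_bot_iff]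
  constructor
  · rintro ⟨x, hx, hx0⟩
    rw [Module.End.mem_eigenspace_iff, Matrix.toLin'_apply] at hx
    refine ⟨WithLp.toLp 2 x, by simpa using hx0, ?_⟩
    rw [Matrix.toLpLin_apply, ← WithLp.toLp_smul, ← hx]
  · rintro ⟨e, he0, he⟩
    refine ⟨WithLp.ofLp e, ?_, by simpa using he0⟩
    rw [Module.End.mem_eigenspace_iff, Matrix.toLin'_apply]
    exact congrArg WithLp.ofLp he

theorem le_of_le_gap {A : Op d} {x μ : ℝ} (h : (x : EReal) ≤ gap A)
    (hμ : μ ∈ eigenvalues A) (hμ0 : μ ≠ 0) : x ≤ μ :=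
  EReal.coe_le_coe_iff.1 (h.trans (sInf_le ⟨μ, ⟨hμ, hμ0⟩, rfl⟩))

theorem eigenvalues_finite (A : Op d) : (eigenvalues A).Finite :=
  (Module.End.finite_hasEigenvalue (Matrix.toLin' A)).preimage Complex.ofReal_injective.injOn

theorem exists_gap_eq {A : Op d} (h : gap A ≠ ⊤) :
    ∃ γ : ℝ, γ ∈ eigenvalues A ∧ γ ≠ 0 ∧ gap A = γ := by
  have hne : (Real.toEReal '' {x : ℝ | x ∈ eigenvalues A ∧ x ≠ 0}).Nonempty := by
    by_contra hc
    rw [Set.not_nonempty_iff_eq_empty] at hc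
    exact h (by rw [gap, hc, sInf_empty])
  obtain ⟨γ, ⟨h1, h2⟩, h3⟩ :=
    hne.csInf_mem (((eigenvalues_finite A).subset fun x hx => hx.1).image _)
  exact ⟨γ, h1, h2, h3.symm⟩

end Gap

end QuditChain

/-! ### The chain as a family of projections -/

namespace QuditChain

section Operators

variable {n : ℕ} {d m : Fin n → ℕ}

/-- The term `P_{ij}` as an operator on the Hilbert space of the chain. -/
noncomputable def term (P : ∀ i : Fin n, Fin (m i) → Op d) (p : Σ i, Fin (m i)) :
    EuclideanSpace ℂ (Config d) →ₗ[ℂ] EuclideanSpace ℂ (Config d) :=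
  Matrix.toEuclideanLin (P p.1 p.2)

/-- The terms supported on the bonds in `S`. -/
def bondTerms (m : Fin n → ℕ) (S : Finset (Fin n)) : Finset (Σ i, Fin (m i)) :=
  S.sigma fun _ => Finset.univ

theorem mem_bondTerms {S : Finset (Fin n)} {p : Σ i, Fin (m i)} :
    p ∈ bondTerms m S ↔ p.1 ∈ S := by
  simp [bondTerms]

variable {P : ∀ i : Fin n, Fin (m i) → Op d}

theorem isSymmetricProjection_term (hproj : ∀ i j, IsStarProjection (P i j))
    (p : Σ i, Fin (m i)) : (term P p).IsSymmetricProjection := by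
  have h := (hproj p.1 p.2).map (Matrix.toEuclideanCLM (n := Config d) (𝕜 := ℂ))
  exact ContinuousLinearMap.isStarProjection_iff_isSymmetricProjection.1 h

theorem commute_term_iff {p q : Σ i, Fin (m i)} :
    Commute (term P p) (term P q) ↔ Commute (P p.1 p.2) (P q.1 q.2) := by
  have hmul : ∀ A B : Op d, Matrix.toEuclideanLin A * Matrix.toEuclideanLin B
      = Matrix.toEuclideanLin (A * B) := fun A B => by
    ext v : 1
    simp [Matrix.toLpLin_apply]
  rw [commute_iff_eq, commute_iff_eq, term, term, hmul, hmul,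
    Matrix.toEuclideanLin.injective.eq_iff]

theorem toEuclideanLin_hamiltonian :
    Matrix.toEuclideanLin (hamiltonian P) = ∑ p, term P p := by
  rw [← Finset.univ_sigma_univ, Finset.sum_sigma, hamiltonian, map_sum]
  simp only [interaction, map_sum]
  rfl

theorem term_eq_zero_of_interaction_eq_zero (hproj : ∀ i j, IsStarProjection (P i j)) {i : Fin n}
    (hi : interaction P i = 0) (j : Fin (m i)) : term P ⟨i, j⟩ = 0 := by
  have hP := isSymmetricProjection_term hproj
  have h0 : ∑ p ∈ bondTerms m {i}, term P p = 0 := by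
    rw [bondTerms, Finset.sum_sigma, Finset.sum_singleton]
    have := congrArg Matrix.toEuclideanLin hi
    rw [interaction, map_sum, map_zero] at this
    exact this
  refine LinearMap.ext fun v => ?_
  have h1 := (ProjectionFamily.sum_apply_eq_zero_iff hP (bondTerms m {i}) v).1 (by rw [h0]; simp)
  exact ProjectionFamily.mem_groundSpace.1 h1 ⟨i, j⟩ (by simp [mem_bondTerms])

variable [NeZero n]

/-- The bonds `i` with both `i` and `i + 1` in the segment of length `t` starting at `a`. -/
def segmentBonds (a : Fin n) (t : ℕ) : Finset (Fin n) :=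
  {i | i ∈ segment a t ∧ i + 1 ∈ segment a t}

theorem toEuclideanLin_localHamiltonian (a : Fin n) (t : ℕ) :
    Matrix.toEuclideanLin (localHamiltonian P (segment a t))
      = ∑ p ∈ bondTerms m (segmentBonds a t), term P p := by
  rw [bondTerms, Finset.sum_sigma, localHamiltonian, map_sum]
  simp only [interaction, map_sum]
  rfl

/-- The comparison of the global gap with the gaps of two families of blocks, each consisting of
pairwise separated blocks, such that the complement of the blocks `b` stays inside the blocks `a`
when fattened `2 L q` times. -/
theorem le_of_blocks (hproj : ∀ i j, IsStarProjection (P i j))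
    (hsupp : ∀ i j, SupportedOn {i, i + 1} (P i j)) {g L q : ℕ} (hq : 0 < q)
    (hg : ∀ p : Σ i, Fin (m i),
      {q : Σ i, Fin (m i) | q ≠ p ∧ ¬ Commute (P p.1 p.2) (P q.1 q.2)}.ncard ≤ g)
    (layer : (Σ i, Fin (m i)) → Fin L)
    (hlayer : ∀ p q, layer p = layer q → Commute (P p.1 p.2) (P q.1 q.2))
    {γ : ℝ} (hγ : gap (hamiltonian P) = γ) (hγe : γ ∈ eigenvalues (hamiltonian P)) (hγ0 : γ ≠ 0)
    (hγg : γ ≤ (g : ℝ) ^ 2 / 4) {t : ℕ} {κ : Type*} (J J' : Finset κ) (a b : κ → Fin n)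
    (ha : ∀ j ∈ J, ∀ k ∈ J, j ≠ k → ∀ x ∈ segmentBonds (a j) t, ∀ y ∈ segmentBonds (a k) t,
      Disjoint ({x, x + 1} : Finset (Fin n)) {y, y + 1})
    (hb : ∀ j ∈ J', ∀ k ∈ J', j ≠ k → ∀ x ∈ segmentBonds (b j) t, ∀ y ∈ segmentBonds (b k) t,
      Disjoint ({x, x + 1} : Finset (Fin n)) {y, y + 1})
    {R : ℕ → Set (Fin n)} (hmono : Monotone R)
    (hR : ∀ s, ∀ x ∈ R s, ∀ y ∉ R (s + 1), Disjoint ({x, x + 1} : Finset (Fin n)) {y, y + 1})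
    (hRb : ∀ x ∉ R 0, (∃ j ∈ J', x ∈ segmentBonds (b j) t) ∨ interaction P x = 0)
    (hRa : ∀ s < 2 * L * q, ∀ x ∈ R s, ∃ j ∈ J, x ∈ segmentBonds (a j) t)
    {Γ : ℝ} (hΓ0 : 0 ≤ Γ) (hΓa : ∀ j ∈ J, (Γ : EReal) ≤ gap (localHamiltonian P (segment (a j) t)))
    (hΓb : ∀ j ∈ J', (Γ : EReal) ≤ gap (localHamiltonian P (segment (b j) t))) :
    Γ ≤ 2 * γ + (g : ℝ) ^ 2 / (q : ℝ) ^ 2 := by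
  classical
  have hcomm : ∀ p p' : Σ i, Fin (m i),
      Disjoint ({p.1, p.1 + 1} : Finset (Fin n)) {p'.1, p'.1 + 1} →
        Commute (term P p) (term P p') := fun p p' h =>
    commute_term_iff.2 ((hsupp p.1 p.2).commute (hsupp p'.1 p'.2) h)
  have hdisj : ∀ x y : Fin n, Disjoint ({x, x + 1} : Finset (Fin n)) {y, y + 1} → x ≠ y := by
    rintro x _ h rfl
    simp at h
  have hspec : ∀ c : Fin n, (Γ : EReal) ≤ gap (localHamiltonian P (segment c t)) →
      ∀ (μ : ℝ) (e : EuclideanSpace ℂ (Config d)), e ≠ 0 →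
        (∑ p ∈ bondTerms m (segmentBonds c t), term P p) e = (μ : ℂ) • e → μ ≠ 0 → Γ ≤ μ := by
    intro c hc μ e he0 he hμ0
    rw [← toEuclideanLin_localHamiltonian] at he
    exact le_of_le_gap hc (mem_eigenvalues_iff.2 ⟨e, he0, he⟩) hμ0
  obtain ⟨ψ, hψ0, hψ⟩ := mem_eigenvalues_iff.1 hγe
  rw [toEuclideanLin_hamiltonian] at hψ
  refine ProjectionFamily.le_of_commuting_blocks (isSymmetricProjection_term hproj) (L := L) hq
    (fun p => ?_) layer (fun p p' h => commute_term_iff.2 (hlayer p p' h)) ?_ hψ0 hψ hγ0 hγg J J'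
    (fun j => bondTerms m (segmentBonds (a j) t)) (fun j => bondTerms m (segmentBonds (b j) t))
    ?_ ?_ ?_ ?_ (R := fun s => {p | p.1 ∈ R s}) (fun s s' h p hp => hmono h hp)
    (fun s p hp p' hp' => hcomm p p' (hR s p.1 hp p'.1 hp')) ?_ ?_ hΓ0
    (fun j hj => hspec _ (hΓa j hj)) (fun j hj => hspec _ (hΓb j hj))
  · refine le_trans (le_of_eq ?_) (hg p)
    rw [← Set.ncard_coe_finset]
    congr 1
    ext p'
    simp [commute_term_iff]
  · intro μ e he0 he hμ0
    rw [← toEuclideanLin_hamiltonian] at he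
    exact le_of_le_gap hγ.ge (mem_eigenvalues_iff.2 ⟨e, he0, he⟩) hμ0
  · intro j hj k hk hjk
    rw [Finset.disjoint_left]
    intro p hp hp'
    rw [mem_bondTerms] at hp hp'
    exact hdisj _ _ (ha j hj k hk hjk p.1 hp p.1 hp') rfl
  · intro j hj k hk hjk p hp p' hp'
    rw [mem_bondTerms] at hp hp'
    exact hcomm p p' (ha j hj k hk hjk p.1 hp p'.1 hp')
  · intro j hj k hk hjk
    rw [Finset.disjoint_left]
    intro p hp hp'
    rw [mem_bondTerms] at hp hp'
    exact hdisj _ _ (hb j hj k hk hjk p.1 hp p.1 hp') rfl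
  · intro j hj k hk hjk p hp p' hp'
    rw [mem_bondTerms] at hp hp'
    exact hcomm p p' (hb j hj k hk hjk p.1 hp p'.1 hp')
  · intro p hp
    rcases hRb p.1 hp with ⟨j, hj, hx⟩ | h
    · exact Or.inl ⟨j, hj, mem_bondTerms.2 hx⟩
    · exact Or.inr (term_eq_zero_of_interaction_eq_zero hproj h p.2)
  · intro s hs p hp
    obtain ⟨j, hj, hx⟩ := hRa s hs p.1 hp
    exact ⟨j, hj, mem_bondTerms.2 hx⟩

end Operators

end QuditChain

/-! ### Segments on the ring and subdivision of the chain -/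

namespace QuditChain

section Segments

variable {n : ℕ}

theorem eq_of_val_eq_add_mul {x y : Fin n} {k : ℤ} (h : (x : ℤ) = y + n * k) : x = y := by
  have h1 : ((x : ℕ) : ℤ) % n = ((y : ℕ) : ℤ) % n := by
    rw [h, Int.add_mul_emod_self_left]
  rw [Int.emod_eq_of_lt (by positivity) (by exact_mod_cast x.2),
    Int.emod_eq_of_lt (by positivity) (by exact_mod_cast y.2)] at h1
  exact Fin.ext (by exact_mod_cast h1)

variable [NeZero n]

theorem exists_val_add_one (x : Fin n) : ∃ c : ℤ, ((x + 1 : Fin n) : ℤ) = x + 1 + n * c := by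
  refine ⟨-(((x : ℤ) + 1) / n), ?_⟩
  rw [Fin.val_add, Fin.val_one', Nat.add_mod_mod]
  push_cast
  rw [Int.emod_def]
  ring

/-- Positions are lifted to the integers, with `k` a winding number, so that membership becomes
linear arithmetic. -/
theorem mem_segment_ofNat_iff {s t : ℕ} {x : Fin n} :
    x ∈ segment (Fin.ofNat n s) t ↔ ∃ k : ℤ, (s : ℤ) ≤ x + n * k ∧ (x : ℤ) + n * k < s + t := by
  have hval : ∀ i : ℕ, ∃ c : ℤ,
      ((Fin.ofNat n s + Fin.ofNat n i : Fin n) : ℤ) = s + i + n * c := by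
    intro i
    refine ⟨-(((s : ℤ) + i) / n), ?_⟩
    rw [Fin.val_add, Fin.val_ofNat, Fin.val_ofNat, ← Nat.add_mod]
    push_cast
    rw [Int.emod_def]
    ring
  simp only [segment, Finset.mem_image, Finset.mem_range]
  constructor
  · rintro ⟨i, hi, rfl⟩
    obtain ⟨c, hc⟩ := hval i
    refine ⟨-c, ?_⟩
    rw [hc, mul_neg]
    omega
  · rintro ⟨k, h1, h2⟩
    obtain ⟨i, hi⟩ := Int.eq_ofNat_of_zero_le (sub_nonneg.2 h1)
    refine ⟨i, by omega, ?_⟩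
    obtain ⟨c, hc⟩ := hval i
    refine eq_of_val_eq_add_mul (k := k + c) ?_
    rw [hc, ← hi]
    ring

theorem mem_segmentBonds_ofNat_iff {s t : ℕ} (ht : t < n) {x : Fin n} :
    x ∈ segmentBonds (Fin.ofNat n s) t ↔
      ∃ k : ℤ, (s : ℤ) ≤ x + n * k ∧ (x : ℤ) + n * k + 2 ≤ s + t := by
  simp only [segmentBonds, Finset.mem_filter, Finset.mem_univ, true_and, mem_segment_ofNat_iff]
  obtain ⟨c, hc⟩ := exists_val_add_one x
  rw [hc]
  constructor
  · rintro ⟨⟨k, h1, h2⟩, k', h3, h4⟩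
    have h5 : (x : ℤ) + 1 + n * c + n * k' = x + n * k + (1 + n * (c + k' - k)) := by ring
    rw [h5] at h3 h4
    refine ⟨k, h1, ?_⟩
    -- Both ends of the bond must lie in the same lift of the segment: a different winding shifts by
    -- at least `n`, too far since `t < n`.
    rcases lt_trichotomy (c + k' - k) 0 with h | h | h
    · have : (n : ℤ) * (c + k' - k) ≤ n * (-1) :=
        mul_le_mul_of_nonneg_left (by omega) (by positivity)
      omega
    · rw [h] at h3 h4
      omega
    · have : (n : ℤ) * 1 ≤ n * (c + k' - k) :=
        mul_le_mul_of_nonneg_left (by omega) (by positivity)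
      omega
  · rintro ⟨k, h1, h2⟩
    refine ⟨⟨k, h1, by omega⟩, k - c, ?_⟩
    rw [mul_sub]
    omega

theorem disjoint_bond_of_forall_ne {x y : Fin n}
    (h : ∀ k : ℤ, (y : ℤ) + n * k < x - 1 ∨ (x : ℤ) + 1 < y + n * k) :
    Disjoint ({x, x + 1} : Finset (Fin n)) {y, y + 1} := by
  obtain ⟨c, hc⟩ := exists_val_add_one x
  obtain ⟨c', hc'⟩ := exists_val_add_one y
  simp only [Finset.disjoint_insert_left, Finset.disjoint_singleton_left, Finset.mem_insert,
    Finset.mem_singleton, not_or]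
  refine ⟨⟨?_, ?_⟩, ?_, ?_⟩ <;> intro heq
  · rw [heq] at h
    have := h 0
    omega
  · rw [← heq] at hc'
    have := h c'
    omega
  · rw [heq] at hc
    have := h (-c)
    rw [mul_neg] at this
    omega
  · rw [heq] at hc
    have := h (c' - c)
    rw [mul_sub] at this
    omega

/-- Segments that do not overlap on the ring have separated bonds. -/
theorem disjoint_of_mem_segmentBonds {s s' t : ℕ} (ht : t < n) (h : s + t ≤ s')
    (h' : s' + t ≤ s + n) {x y : Fin n} (hx : x ∈ segmentBonds (Fin.ofNat n s) t)
    (hy : y ∈ segmentBonds (Fin.ofNat n s') t) :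
    Disjoint ({x, x + 1} : Finset (Fin n)) {y, y + 1} := by
  rw [mem_segmentBonds_ofNat_iff ht] at hx hy
  obtain ⟨k, hx1, hx2⟩ := hx
  obtain ⟨k', hy1, hy2⟩ := hy
  refine disjoint_bond_of_forall_ne fun l => ?_
  have h1 : (n : ℤ) * l = n * k' - n * k + n * (l + k - k') := by ring
  rw [h1]
  rcases lt_or_ge (l + k - k') 0 with h2 | h2
  · have : (n : ℤ) * (l + k - k') ≤ n * (-1) :=
      mul_le_mul_of_nonneg_left (by omega) (by positivity)
    omega
  · have : (0 : ℤ) ≤ n * (l + k - k') := by positivity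
    omega

end Segments

/-- A length `M ≥ 4 t` splits into steps of length between `t` and about `5 t / 4`. -/
theorem exists_steps {M t : ℕ} (ht : 0 < t) (hM : 4 * t ≤ M) :
    ∃ (K : ℕ) (e : ℕ → ℕ), e 0 = 0 ∧ e K = M ∧ 0 < K ∧
      ∀ j < K, e j + t ≤ e (j + 1) ∧ 4 * e (j + 1) ≤ 4 * e j + 5 * t + 2 := by
  set K := M / t with hK
  have hK4 : 4 ≤ K := (Nat.le_div_iff_mul_le ht).2 hM
  have hKt : K * t ≤ M := Nat.div_mul_le_self M t
  have hMt : M < K * t + t := by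
    have := Nat.lt_div_mul_add (a := M) ht
    simpa [hK] using this
  set u := M / K with hu
  set r := M % K with hr
  have hrK : r < K := Nat.mod_lt _ (by omega)
  have hMur : K * u + r = M := Nat.div_add_mod M K
  have hut : t ≤ u := (Nat.le_div_iff_mul_le (by omega)).2 (by rwa [mul_comm])
  have hu4 : 4 * (u - t) + r < t := by
    obtain ⟨w, hw⟩ := Nat.exists_eq_add_of_le hut
    rw [hw] at hMur ⊢
    have : 4 * w ≤ K * w := Nat.mul_le_mul_right w hK4
    rw [mul_add] at hMur
    omega
  -- The first `r` steps have length `u + 1`, the others `u`. As `K ≥ 4`, the excess over `t` is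
  -- about `t/4` at most; the `+ 2` absorbs rounding.
  refine ⟨K, fun j => j * u + min j r, by simp, ?_, by omega, fun j hj => ?_⟩
  · simp only [min_eq_right hrK.le]
    exact hMur
  · simp only [Nat.succ_mul]
    omega

theorem add_le_of_steps {e : ℕ → ℕ} {K t : ℕ} (h : ∀ j < K, e j + t ≤ e (j + 1)) {j k : ℕ}
    (hjk : j < k) (hk : k ≤ K) : e j + t ≤ e k := by
  induction k, hjk using Nat.le_induction with
  | base => exact h j (by omega)
  | succ k hk' ih =>
    have := h k (by omega)
    have := ih (by omega)
    omega

theorem exists_step_of_lt {e : ℕ → ℕ} (h0 : e 0 = 0) {K x : ℕ} (hx : x < e K) :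
    ∃ j < K, e j ≤ x ∧ x < e (j + 1) := by
  induction K with
  | zero => omega
  | succ K ih =>
    by_cases h : x < e K
    · obtain ⟨j, hj, h1⟩ := ih h
      exact ⟨j, by omega, h1⟩
    · exact ⟨K, by omega, by omega, hx⟩

/-! ### Fattened gaps between segments -/

section FattenedGaps

variable {n : ℕ}

/-- The bonds at distance at most `s` from the gap after one of the first `K` segments of length
`t` with starting points `e`. -/
def fattenedGaps (n : ℕ) (e : ℕ → ℕ) (K t s : ℕ) : Set (Fin n) :=
  {x | ∃ j < K, ∃ k : ℤ, (e j : ℤ) + t - 1 - s ≤ x + n * k ∧ (x : ℤ) + n * k + 1 ≤ e (j + 1) + s}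

theorem monotone_fattenedGaps (e : ℕ → ℕ) (K t : ℕ) : Monotone (fattenedGaps n e K t) := by
  rintro s s' h x ⟨j, hj, k, h1, h2⟩
  exact ⟨j, hj, k, by omega, by omega⟩

theorem disjoint_of_mem_fattenedGaps [NeZero n] {e : ℕ → ℕ} {K t s : ℕ} {x y : Fin n}
    (hx : x ∈ fattenedGaps n e K t s) (hy : y ∉ fattenedGaps n e K t (s + 1)) :
    Disjoint ({x, x + 1} : Finset (Fin n)) {y, y + 1} := by
  obtain ⟨j, hj, k, h1, h2⟩ := hx
  refine disjoint_bond_of_forall_ne fun l => ?_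
  by_contra hc
  refine hy ⟨j, hj, l + k, ?_⟩
  rw [mul_add]
  push_cast
  omega

end FattenedGaps

/-! ### Geometry of the two rows of segments -/

section MainEstimate

variable {n : ℕ} [NeZero n] {d m : Fin n → ℕ} {P : ∀ i : Fin n, Fin (m i) → Op d}

/-- With `q = t / (31 L) + 1` repetitions of the detectability-lemma operator, the light cone
`2 L q` fits into the overlap of the segments. -/
theorem light_cone_bound {L t : ℕ} (hL : 0 < L) (hLt : 8 * L ^ 2 < t) :
    8 * (2 * L * (t / (31 * L) + 1)) + 10 ≤ 3 * t ∧
      (t : ℝ) ≤ 31 * L * ((t / (31 * L) + 1 : ℕ) : ℝ) := by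
  constructor
  · have h1 : 31 * L * (t / (31 * L)) ≤ t := Nat.mul_div_le t (31 * L)
    have h2 : 2 * L * (t / (31 * L) + 1) = 2 * (L * (t / (31 * L))) + 2 * L := by ring
    rw [h2]
    rw [mul_assoc] at h1
    set w := L * (t / (31 * L))
    -- For `L ≥ 2`, `16 L ≤ 8 L² < t` absorbs the rounding of `q`. For `L = 1` this fails, and the
    -- bound is checked directly from `t ≥ 9`.
    rcases Nat.lt_or_ge L 2 with h | h
    · have : L = 1 := by omega
      subst this
      omega
    · have : 2 * L ≤ L ^ 2 := by nlinarith
      omega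
  · have h := (Nat.lt_mul_div_succ t (show 0 < 31 * L by omega)).le
    exact_mod_cast h

/-- The bound on the local gap `Γ` of the segments starting at the points `e j` (`j < K'`) and
`e j + t - 1 - 2 L q` (`j < K`). -/
theorem le_of_steps (hproj : ∀ i j, IsStarProjection (P i j))
    (hsupp : ∀ i j, SupportedOn {i, i + 1} (P i j)) {g L : ℕ}
    (hg : ∀ p : Σ i, Fin (m i),
      {q : Σ i, Fin (m i) | q ≠ p ∧ ¬ Commute (P p.1 p.2) (P q.1 q.2)}.ncard ≤ g)
    (layer : (Σ i, Fin (m i)) → Fin L)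
    (hlayer : ∀ p q, layer p = layer q → Commute (P p.1 p.2) (P q.1 q.2))
    {γ : ℝ} (hγ : gap (hamiltonian P) = γ) (hγe : γ ∈ eigenvalues (hamiltonian P)) (hγ0 : γ ≠ 0)
    (hγg : γ ≤ (g : ℝ) ^ 2 / 4) {t : ℕ} (ht : t < n) {q N : ℕ} (hq : 0 < q) (hN : N = 2 * L * q)
    (hNt : 8 * N + 10 ≤ 3 * t) {K K' : ℕ} {e : ℕ → ℕ} (he0 : e 0 = 0)
    (he : ∀ j < K, e j + t ≤ e (j + 1) ∧ 4 * e (j + 1) ≤ 4 * e j + 5 * t + 2)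
    (heK : e K ≤ n) (hKK' : K ≤ K') (hK' : ∀ j < K', j ≤ K ∧ e j + t ≤ n)
    (hcov : ∀ x : Fin n, e K ≤ x → interaction P x = 0 ∨ (K < K' ∧ (x : ℕ) + 2 ≤ e K + t))
    {Γ : ℝ} (hΓ0 : 0 ≤ Γ)
    (hΓ : ∀ j < K', (Γ : EReal) ≤ gap (localHamiltonian P (segment (Fin.ofNat n (e j)) t)))
    (hΓ' : ∀ j < K,
      (Γ : EReal) ≤ gap (localHamiltonian P (segment (Fin.ofNat n (e j + (t - 1 - N))) t))) :
    Γ ≤ 2 * γ + (g : ℝ) ^ 2 / (q : ℝ) ^ 2 := by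
  have hstep : ∀ j k, j < k → k ≤ K → e j + t ≤ e k := fun j k hjk hk =>
    add_le_of_steps (fun j hj => (he j hj).1) hjk hk
  have hodd : ∀ j k, j < k → k < K → ∀ x ∈ segmentBonds (Fin.ofNat n (e j + (t - 1 - N))) t,
      ∀ y ∈ segmentBonds (Fin.ofNat n (e k + (t - 1 - N))) t,
      Disjoint ({x, x + 1} : Finset (Fin n)) {y, y + 1} := by
    intro j k hjk hk x hx y hy
    have h1 := hstep j k hjk hk.le
    have h2 := hstep k K hk le_rfl
    exact disjoint_of_mem_segmentBonds ht (by omega) (by omega) hx hy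
  have heven : ∀ j k, j < k → k < K' → ∀ x ∈ segmentBonds (Fin.ofNat n (e j)) t,
      ∀ y ∈ segmentBonds (Fin.ofNat n (e k)) t,
      Disjoint ({x, x + 1} : Finset (Fin n)) {y, y + 1} := by
    intro j k hjk hk x hx y hy
    have h1 := hstep j k hjk (hK' k hk).1
    have h2 := (hK' k hk).2
    exact disjoint_of_mem_segmentBonds ht h1 (by omega) hx hy
  refine le_of_blocks hproj hsupp hq hg layer hlayer hγ hγe hγ0 hγg (t := t)
    (Finset.range K) (Finset.range K') (fun j => Fin.ofNat n (e j + (t - 1 - N)))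
    (fun j => Fin.ofNat n (e j)) ?_ ?_ (monotone_fattenedGaps e K t)
    (fun s x hx y hy => disjoint_of_mem_fattenedGaps hx hy) ?_ ?_ hΓ0
    (fun j hj => hΓ' j (Finset.mem_range.1 hj)) (fun j hj => hΓ j (Finset.mem_range.1 hj))
  · intro j hj k hk hjk x hx y hy
    rw [Finset.mem_range] at hj hk
    rcases lt_or_gt_of_ne hjk with h | h
    · exact hodd j k h hk x hx y hy
    · exact (hodd k j h hj y hy x hx).symm
  · intro j hj k hk hjk x hx y hy
    rw [Finset.mem_range] at hj hk
    rcases lt_or_gt_of_ne hjk with h | h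
    · exact heven j k h hk x hx y hy
    · exact (heven k j h hj y hy x hx).symm
  · intro x hx
    simp only [Finset.mem_range, mem_segmentBonds_ofNat_iff ht]
    by_cases hxK : (x : ℕ) < e K
    · obtain ⟨j, hj, h1, h2⟩ := exists_step_of_lt he0 hxK
      refine Or.inl ⟨j, by omega, 0, by omega, ?_⟩
      by_contra hc
      -- The bond `e j + t - 1` leaving the segment belongs to the gap, so a gap contains a bond
      -- even when the next segment starts right at `e j + t`.
      exact hx ⟨j, hj, 0, by omega, by omega⟩
    · rcases hcov x (by omega) with h | ⟨h1, h2⟩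
      · exact Or.inr h
      · exact Or.inl ⟨K, h1, 0, by omega, by omega⟩
  · rintro s hs x ⟨j, hj, k, h1, h2⟩
    have h3 := (he j hj).2
    rw [← hN] at hs
    simp only [Finset.mem_range, mem_segmentBonds_ofNat_iff ht]
    -- The shifted segment starts `N` bonds before the gap. A gap is at most about `t/4` long, so
    -- fattening on both sides fits once `2N` is at most about `3t/4`; this is `hNt`.
    exact ⟨j, hj, k, by omega, by omega⟩

end MainEstimate

end QuditChain

/-! ### The closed and the open chain -/

theorem theorem1 (n : ℕ) [NeZero n] (d m : Fin n → ℕ)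
    (P : ∀ i : Fin n, Fin (m i) → QuditChain.Op d)
    (hproj : ∀ i j, IsStarProjection (P i j))
    (hsupp : ∀ i j, QuditChain.SupportedOn {i, i + 1} (P i j))
    (hff : QuditChain.FrustrationFree P)
    (g L : ℕ)
    (hg : ∀ p : Σ i, Fin (m i),
      {q : Σ i, Fin (m i) | q ≠ p ∧ ¬ Commute (P p.1 p.2) (P q.1 q.2)}.ncard ≤ g)
    (layer : (Σ i, Fin (m i)) → Fin L)
    (hlayer : ∀ p q, layer p = layer q → Commute (P p.1 p.2) (P q.1 q.2))
    (hgap : QuditChain.gap (QuditChain.hamiltonian P) ≤ (((g : ℝ) ^ 2 / 4 : ℝ) : EReal))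
    (t : ℕ) (hLt : 8 * L ^ 2 < t) (htn : (t : ℝ) < (n : ℝ) / 5) :
    -- closed chain
    QuditChain.closedLocalGap P t
        ≤ ((10 ^ 3 * (L : ℝ) ^ 2 * (g : ℝ) ^ 2 / (t : ℝ) ^ 2 : ℝ) : EReal)
          + 6 * QuditChain.gap (QuditChain.hamiltonian P) ∧
    -- open chain: the interaction between the last and the first qudit vanishes
    ((∀ i : Fin n, (i : ℕ) + 1 = n → QuditChain.interaction P i = 0) →
      QuditChain.openLocalGap P t
        ≤ ((10 ^ 3 * (L : ℝ) ^ 2 * (g : ℝ) ^ 2 / (t : ℝ) ^ 2 : ℝ) : EReal)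
          + 6 * QuditChain.gap (QuditChain.hamiltonian P)) := by
  obtain ⟨γ, hγe, hγ0, hγ⟩ := QuditChain.exists_gap_eq (ne_top_of_le_ne_top (EReal.coe_ne_top _) hgap)
  have hγpos : 0 ≤ γ := hff.2 hγe
  have hγg : γ ≤ (g : ℝ) ^ 2 / 4 := by
    rw [hγ] at hgap
    exact EReal.coe_le_coe_iff.1 hgap
  -- Without layers there are no terms, and `H = 0` has no nonzero eigenvalue.
  have hL : 0 < L := by
    rcases Nat.eq_zero_or_pos L with rfl | h
    · obtain ⟨ψ, hψ0, hψ⟩ := QuditChain.mem_eigenvalues_iff.1 hγe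
      rw [QuditChain.toEuclideanLin_hamiltonian,
        Finset.sum_eq_zero fun p _ => (layer p).elim0, LinearMap.zero_apply, eq_comm,
        smul_eq_zero] at hψ
      exact absurd hψ (by simp [hγ0, hψ0])
    · exact h
  have hn : 5 * t < n := by
    have : (5 * t : ℝ) < n := by linarith
    exact_mod_cast this
  obtain ⟨hN, hq⟩ := QuditChain.light_cone_bound hL hLt
  set q := t / (31 * L) + 1
  have hq0 : 0 < q := Nat.succ_pos _
  have ht0 : 0 < t := by omega
  set r : ℝ := 10 ^ 3 * (L : ℝ) ^ 2 * (g : ℝ) ^ 2 / (t : ℝ) ^ 2 + 6 * γ with hr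
  have hrhs : ((10 ^ 3 * (L : ℝ) ^ 2 * (g : ℝ) ^ 2 / (t : ℝ) ^ 2 : ℝ) : EReal)
      + 6 * QuditChain.gap (QuditChain.hamiltonian P) = (r : EReal) := by
    rw [hγ, hr, EReal.coe_add, EReal.coe_mul 6 γ]
    rfl
  have hr0 : 0 ≤ r := by positivity
  -- From `t ≤ 31 L q` and `31² = 961 ≤ 10³`.
  have hbound : 2 * γ + (g : ℝ) ^ 2 / (q : ℝ) ^ 2 ≤ r := by
    have h1 : (g : ℝ) ^ 2 / (q : ℝ) ^ 2
        ≤ 10 ^ 3 * (L : ℝ) ^ 2 * (g : ℝ) ^ 2 / (t : ℝ) ^ 2 := by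
      rw [div_le_div_iff₀ (by positivity) (by positivity)]
      have h2 : (t : ℝ) ^ 2 ≤ (31 * L * q) ^ 2 := by gcongr
      have h3 : (0 : ℝ) ≤ (L : ℝ) ^ 2 * (g : ℝ) ^ 2 * (q : ℝ) ^ 2 := by positivity
      nlinarith [mul_le_mul_of_nonneg_left h2 (sq_nonneg (g : ℝ))]
    linarith
  rw [hrhs]
  constructor
  · by_contra! hlt
    -- The local gap may be `⊤`, so a real number strictly between the two sides takes its place.
    obtain ⟨Γ, hΓr, hΓ⟩ := EReal.lt_iff_exists_real_btwn.1 hlt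
    rw [EReal.coe_lt_coe_iff] at hΓr
    have hle : ∀ a, (Γ : EReal) ≤ QuditChain.gap
        (QuditChain.localHamiltonian P (QuditChain.segment a t)) := fun a =>
      hΓ.le.trans (iInf_le _ a)
    -- The whole ring is subdivided; the last gap ends at `n`, where the first segment starts again.
    obtain ⟨K, e, he0, heK, hK0, he⟩ := QuditChain.exists_steps ht0 (show 4 * t ≤ n by omega)
    have := QuditChain.le_of_steps hproj hsupp hg layer hlayer hγ hγe hγ0 hγg (by omega) hq0 rfl hN
      he0 he heK.le le_rfl
      (fun j hj => ⟨hj.le, heK ▸ QuditChain.add_le_of_steps (fun j hj => (he j hj).1) hj le_rfl⟩)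
      (fun x hx => absurd x.2 (by omega)) (hr0.trans hΓr.le) (fun j _ => hle _) (fun j _ => hle _)
    linarith
  · intro hopen
    by_contra! hlt
    obtain ⟨Γ, hΓr, hΓ⟩ := EReal.lt_iff_exists_real_btwn.1 hlt
    rw [EReal.coe_lt_coe_iff] at hΓr
    have hle : ∀ s, s + t ≤ n → (Γ : EReal) ≤ QuditChain.gap
        (QuditChain.localHamiltonian P (QuditChain.segment (Fin.ofNat n s) t)) := fun s hs =>
      hΓ.le.trans (iInf_le (fun a : {a : Fin n // (a : ℕ) + t ≤ n} => QuditChain.gap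
        (QuditChain.localHamiltonian P (QuditChain.segment a.1 t)))
        ⟨Fin.ofNat n s, by rwa [Fin.val_ofNat, Nat.mod_eq_of_lt (by omega)]⟩)
    -- Only `n - t` is subdivided, which is possible because `5 t < n`. An extra segment starting at
    -- `e K = n - t` covers the end of the chain, and the shifted segments do not wrap around.
    obtain ⟨K, e, he0, heK, hK0, he⟩ :=
      QuditChain.exists_steps ht0 (show 4 * t ≤ n - t by omega)
    have hend : ∀ j < K, e j + t ≤ e K := fun j hj =>
      QuditChain.add_le_of_steps (fun j hj => (he j hj).1) hj le_rfl
    have hstart : ∀ j < K + 1, e j + t ≤ n := by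
      intro j hj
      rcases Nat.lt_succ_iff_lt_or_eq.1 hj with h | rfl
      · have := hend j h
        omega
      · omega
    have := QuditChain.le_of_steps hproj hsupp hg layer hlayer hγ hγe hγ0 hγg (by omega) hq0 rfl hN
      he0 he (by omega) (Nat.le_succ K)
      (fun j hj => ⟨Nat.lt_succ_iff.1 hj, hstart j hj⟩)
      (fun x hx => by
        rcases Nat.lt_or_ge ((x : ℕ) + 1) n with h | h
        · exact Or.inr ⟨Nat.lt_succ_self K, by omega⟩
        · exact Or.inl (hopen x (by have := x.2; omega)))
      (hr0.trans hΓr.le) (fun j hj => hle _ (hstart j hj))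
      (fun j hj => hle _ (by have := hend j hj; omega))
    linarith
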